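/- **Setting.** An $n$-valent plabic graph $\Gamma$ is a finite connected graph embedded in a rectangle, with $n$ univalent vertices on each of the two vertical sides (the boundary vertices), all other vertices being interior to the rectangle and coloured black or white. Its faces are the connected components of its complement in the rectangle. Each edge joining two internal vertices of different colours has a dual arrow, crossing it with the white endpoint on the left and the black endpoint on the right; an edge joining an internal vertex and a boundary vertex has a dual half-arrow, with the white endpoint (if any) on its left and the black endpoint (if any) on its right. Let $q_{ij}$ be the number of arrows from the face $i$ to the face $j$ minus the number of arrows from $j$ to $i$, half-arrows counting as $\tfrac12$. The space of face weightings is $\mathcal F(\Gamma)=\{(y_i)\in(\mathbb C^*)^{\mathrm{faces}} : \prod_i y_i=1\}$, with the Poisson bracket $\{y_i,y_j\}'=q_{ij}y_iy_j$. A square move at a square face $k$ (whose vertices are trivalent and of alternating colours) changes the colours of the four vertices of the square, replaces $y_k$ by $y_k^{-1}$, and for each arrow $i\to k$ (resp. $k\to i$) multiplies $y_i$ by $1+y_k$ (resp. $(1+y_k^{-1})^{-1}$). The graph $\Gamma$ is move-symmetric if performing square moves at all square faces on the midline having two opposite vertices on the midline, and then reflecting in the midline, gives $\Gamma$ with opposite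 vertex colours. For such a $\Gamma$ this procedure defines a birational Poisson involution $\sigma$ of $\mathcal F(\Gamma)$; let $\mathcal F^{ms}(\Gamma)$ be its fixed point set (in the domain of $\sigma$, that is, where $y_k\ne-1$ for the squares $k$ used). The induced Poisson bracket $\{f,g\}$ of functions on $\mathcal F^{ms}(\Gamma)$ is the restriction to $\mathcal F^{ms}(\Gamma)$ of $\{F,G\}'$ for any $\sigma$-invariant extensions $F$, $G$ of $f$, $g$ to the domain of $\sigma$ in $\mathcal F(\Gamma)$. **Proposition.** Let $\Gamma$ be a move-symmetric $n$-valent plabic graph with $n$ odd, and denote by $i'$ the face symmetric to the face $i$ with respect to the midline. There are constants $c_i>0$, for the faces $i$ above the midline, such that $y_{i'}=c_iy_i$ on $\mathcal F^{ms}(\Gamma)$. With $\sqrt{y_iy_{i'}}:=\sqrt{c_i}\,y_i$, for all faces $i$, $j$ above the midline the functions $\sqrt{y_iy_{i'}}$ and $\sqrt{y_jy_{j'}}$ on $\mathcal F^{ms}(\Gamma)$ have $\sigma$-invariant extensions, and their induced Poisson bracket is $$\{\sqrt{y_iy_{i'}},\sqrt{y_jy_{j'}}\}=\tfrac14\,(q_{ij}+q_{i'j'})\,\sqrt{y_iy_{i'}}\,\sqrt{y_jy_{j'}}.$$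 In other words, the number of arrows from $i$ to $j$ in the quiver defining this bracket is, up to a factor $\tfrac12$, the average of the corresponding numbers $q_{ij}$ and $q_{i'j'}$ in the upper and lower halves of the dual quiver. -/

import Mathlib

open Set Filter Topology

noncomputable section

/-- The rectangle (normalised to the square with sides `[-1, 1]`), without its boundary.
The midline of the rectangle is the part of the real axis in it. -/
def openRect : Set ℂ := Ioo (-1) 1 ×ℂ Ioo (-1) 1

/-- An `n`-valent plabic graph: a finite connected graph (loops and multiple edges are allowed)
embedded in the rectangle by regular `C¹` arcs, with `n` univalent vertices on each of the two
vertical sides, all other vertices being in the interior of the rectangle and coloured. -/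
structure PlabicGraph (n : ℕ) where
  /-- the black internal vertices -/
  black : Finset ℂ
  /-- the white internal vertices -/
  white : Finset ℂ
  disjoint_colors : Disjoint black white
  internal_mem : ∀ v ∈ black ∪ white, v ∈ openRect
  /-- the heights of the boundary vertices on the left side, from bottom up -/
  leftHt : Fin n → ℝ
  /-- the heights of the boundary vertices on the right side, from bottom up -/
  rightHt : Fin n → ℝ
  leftHt_mono : StrictMono leftHt
  rightHt_mono : StrictMono rightHt
  leftHt_mem : ∀ i, leftHt i ∈ Ioo (-1 : ℝ) 1
  rightHt_mem : ∀ i, rightHt i ∈ Ioo (-1 : ℝ) 1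
  /-- the edges -/
  Edge : Type
  [fintypeEdge : Fintype Edge]
  /-- the edge `e` is the image of `[0, 1]` under `arc e` -/
  arc : Edge → ℝ → ℂ
  arc_contDiff : ∀ e, ContDiff ℝ 1 (arc e)
  arc_regular : ∀ e, ∀ t ∈ Icc (0 : ℝ) 1, deriv (arc e) t ≠ 0
  /-- edges end at vertices -/
  arc_end : ∀ e, ∀ b : Bool, (arc e (cond b 1 0) ∈ black ∪ white) ∨
    (∃ i, arc e (cond b 1 0) = ⟨-1, leftHt i⟩) ∨ (∃ i, arc e (cond b 1 0) = ⟨1, rightHt i⟩)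
  /-- the interior of an edge is in the interior of the rectangle and contains no vertex -/
  arc_mem : ∀ e, ∀ t ∈ Ioo (0 : ℝ) 1, arc e t ∈ openRect ∧ arc e t ∉ black ∪ white
  /-- edges have no self-intersections and do not meet each other, except at endpoints -/
  arc_inj : ∀ e f, ∀ s ∈ Ioo (0 : ℝ) 1, ∀ t ∈ Ioo (0 : ℝ) 1, arc e s = arc f t → e = f ∧ s = t
  /-- the boundary vertices are univalent -/
  left_univalent : ∀ i, ∃! p : Edge × Bool, arc p.1 (cond p.2 1 0) = ⟨-1, leftHt i⟩
  right_univalent : ∀ i, ∃! p : Edge × Bool, arc p.1 (cond p.2 1 0) = ⟨1, rightHt i⟩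
  /-- the graph is connected -/
  connected : IsConnected
    ((↑(black ∪ white) : Set ℂ) ∪ (⋃ e, arc e '' Icc (0 : ℝ) 1))

namespace PlabicGraph

attribute [instance] PlabicGraph.fintypeEdge

variable {n : ℕ} (Γ : PlabicGraph n)

/-- The set of internal vertices. -/
def internal : Finset ℂ := Γ.black ∪ Γ.white

/-- The edge `e` as a subset of the plane (with its endpoints). -/
def edgeSet (e : Γ.Edge) : Set ℂ := Γ.arc e '' Icc (0 : ℝ) 1

/-- The start (`b = false`) or the end (`b = true`) of the edge `e`. -/
def endpoint (e : Γ.Edge) (b : Bool) : ℂ := Γ.arc e (cond b 1 0)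

/-- The graph as a subset of the plane. The boundary vertices, being univalent, are in it. -/
def carrier : Set ℂ := (↑Γ.internal : Set ℂ) ∪ ⋃ e, Γ.edgeSet e

/-- The number of edges at `v`, a loop being counted twice. -/
def degree (v : ℂ) : ℕ := Nat.card {p : Γ.Edge × Bool // Γ.endpoint p.1 p.2 = v}

/-- The complement of the graph in the rectangle. -/
def compl : Set ℂ := openRect \ Γ.carrier

/-- The faces are the connected components of the complement of the graph in the rectangle. -/
def Face : Type := {F : Set ℂ // ∃ p ∈ Γ.compl, F = connectedComponentIn Γ.compl p}

end PlabicGraph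

/-! ### There are finitely many faces -/

theorem isOpen_openRect : IsOpen openRect := isOpen_Ioo.reProdIm isOpen_Ioo

theorem isPreconnected_openRect_diff (V : Set ℂ) (hV : V.Finite) :
    IsPreconnected (openRect \ V) := by
  have hpi := Real.pi_pos
  set g : ℝ → ℝ := fun x => 2 / Real.pi * Real.arctan x with hg
  have hgi : Function.Injective g := by
    intro x y h
    exact Real.arctan_injective (mul_left_cancel₀ (by positivity) h)
  have hgm : ∀ x, g x ∈ Ioo (-1 : ℝ) 1 := by
    intro x
    have h1 := Real.neg_pi_div_two_lt_arctan x
    have h2 := Real.arctan_lt_pi_div_two x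
    constructor
    · have : 2 / Real.pi * (-(Real.pi / 2)) < g x := mul_lt_mul_of_pos_left h1 (by positivity)
      have h3 : 2 / Real.pi * (-(Real.pi / 2)) = -1 := by field_simp
      linarith
    · have : g x < 2 / Real.pi * (Real.pi / 2) := mul_lt_mul_of_pos_left h2 (by positivity)
      have h3 : 2 / Real.pi * (Real.pi / 2) = 1 := by field_simp
      linarith
  have hgs : ∀ y ∈ Ioo (-1 : ℝ) 1, ∃ x, g x = y := by
    intro y hy
    have h : Real.pi / 2 * y ∈ range Real.arctan := by
      rw [Real.range_arctan]
      constructor <;> nlinarith [hy.1, hy.2]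
    obtain ⟨x, hx⟩ := h
    refine ⟨x, ?_⟩
    simp only [hg, hx]
    field_simp
  have hgc : Continuous g := continuous_const.mul Real.continuous_arctan
  set Ψ : ℂ → ℂ := fun z => ⟨g z.re, g z.im⟩ with hΨ
  have hΨc : Continuous Ψ := by
    have : Ψ = fun z : ℂ => ((g z.re : ℝ) : ℂ) + ((g z.im : ℝ) : ℂ) * Complex.I := by
      funext z
      simp [hΨ, Complex.ext_iff]
    rw [this]
    have h1 : Continuous fun z : ℂ => g z.re := hgc.comp Complex.continuous_re
    have h2 : Continuous fun z : ℂ => g z.im := hgc.comp Complex.continuous_im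
    fun_prop
  have hΨi : Function.Injective Ψ := by
    intro z w h
    simp only [hΨ, Complex.mk.injEq] at h
    exact Complex.ext (hgi h.1) (hgi h.2)
  have himg : openRect \ V = Ψ '' (Ψ ⁻¹' V)ᶜ := by
    ext z
    constructor
    · rintro ⟨hz, hzV⟩
      obtain ⟨x, hx⟩ := hgs z.re hz.1
      obtain ⟨y, hy⟩ := hgs z.im hz.2
      have : Ψ ⟨x, y⟩ = z := Complex.ext hx hy
      exact ⟨⟨x, y⟩, by simpa [this] using hzV, this⟩
    · rintro ⟨w, hw, rfl⟩
      exact ⟨⟨hgm _, hgm _⟩, hw⟩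
  rw [himg]
  refine IsPreconnected.image ?_ _ hΨc.continuousOn
  exact ((hV.preimage hΨi.injOn).countable.isConnected_compl_of_one_lt_rank
    (by rw [Complex.rank_real_complex]; norm_num)).isPreconnected

namespace PlabicGraph

variable {n : ℕ} (Γ : PlabicGraph n)

theorem isClosed_edgeSet (e : Γ.Edge) : IsClosed (Γ.edgeSet e) :=
  (isCompact_Icc.image (Γ.arc_contDiff e).continuous).isClosed

theorem isClosed_carrier : IsClosed Γ.carrier :=
  Γ.internal.finite_toSet.isClosed.union (isClosed_iUnion_of_finite Γ.isClosed_edgeSet)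

theorem isOpen_compl : IsOpen Γ.compl := isOpen_openRect.sdiff Γ.isClosed_carrier

/-- An endpoint of an edge is an internal vertex or is not in the open rectangle. -/
theorem endpoint_cases (e : Γ.Edge) (b : Bool) :
    Γ.endpoint e b ∈ Γ.internal ∨ Γ.endpoint e b ∉ openRect := by
  rcases Γ.arc_end e b with h | ⟨i, h⟩ | ⟨i, h⟩
  · exact Or.inl h
  · right
    intro hm
    have := hm.1
    simp [endpoint, h] at this
  · right
    intro hm
    have := hm.1
    simp [endpoint, h] at this

theorem mem_edgeSet_cases {e : Γ.Edge} {z : ℂ} (hz : z ∈ Γ.edgeSet e) (hr : z ∈ openRect) :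
    z ∈ Γ.internal ∨ ∃ t ∈ Ioo (0 : ℝ) 1, Γ.arc e t = z := by
  obtain ⟨t, ht, rfl⟩ := hz
  rcases eq_or_lt_of_le ht.1 with h0 | h0
  · rcases Γ.endpoint_cases e false with h | h
    · left; simpa [endpoint, ← h0] using h
    · exact absurd (by simpa [endpoint, ← h0] using hr) h
  rcases eq_or_lt_of_le ht.2 with h1 | h1
  · rcases Γ.endpoint_cases e true with h | h
    · left; simpa [endpoint, h1] using h
    · exact absurd (by simpa [endpoint, h1] using hr) h
  · exact Or.inr ⟨t, ⟨h0, h1⟩, rfl⟩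

/-- Near an inner point of an edge, the complement of the graph consists of two strips. -/
theorem exists_strips (e : Γ.Edge) (t₀ : ℝ) (ht₀ : t₀ ∈ Ioo (0 : ℝ) 1) :
    ∃ A B : Set ℂ, IsPreconnected A ∧ IsPreconnected B ∧ A ⊆ Γ.compl ∧ B ⊆ Γ.compl ∧
      (∃ W ∈ 𝓝 (Γ.arc e t₀), W ∩ Γ.compl ⊆ A ∪ B) ∧
      ∀ᶠ t in 𝓝 t₀, Γ.arc e t ∈ closure A ∧ Γ.arc e t ∈ closure B := by
  set γ := Γ.arc e with hγ
  have hγc : Continuous γ := (Γ.arc_contDiff e).continuous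
  have hγd : Differentiable ℝ γ := (Γ.arc_contDiff e).differentiable one_ne_zero
  set d := deriv γ t₀ with hd
  have hd0 : d ≠ 0 := Γ.arc_regular e t₀ ⟨ht₀.1.le, ht₀.2.le⟩
  set a : ℝ → ℝ := fun t => (γ t / d).re with ha
  set b : ℝ → ℝ := fun t => (γ t / d).im with hb
  have hac : Continuous a := Complex.continuous_re.comp (hγc.div_const d)
  have hbc : Continuous b := Complex.continuous_im.comp (hγc.div_const d)
  have hda : ∀ t, HasDerivAt a (deriv γ t / d).re t := fun t => by
    have h := ((hγd t).hasDerivAt.div_const d)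
    exact (Complex.reCLM.hasFDerivAt.comp_hasDerivAt t h)
  have hdc : Continuous fun t => (deriv γ t / d).re :=
    Complex.continuous_re.comp (((Γ.arc_contDiff e).continuous_deriv le_rfl).div_const d)
  have hpos : ∀ᶠ t in 𝓝 t₀, 0 < (deriv γ t / d).re := by
    refine hdc.continuousAt.eventually (lt_mem_nhds ?_)
    change 0 < (d / d).re
    rw [div_self hd0]
    norm_num
  obtain ⟨η, hη, hball⟩ := Metric.eventually_nhds_iff_ball.1
    (hpos.and (isOpen_Ioo.mem_nhds ht₀))
  rw [Real.ball_eq_Ioo] at hball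
  have hmono : StrictMonoOn a (Ioo (t₀ - η) (t₀ + η)) := by
    refine strictMonoOn_of_deriv_pos (convex_Ioo _ _) hac.continuousOn ?_
    intro t ht
    rw [interior_Ioo] at ht
    rw [(hda t).deriv]
    exact (hball t ht).1
  set K : Set ℂ := (↑Γ.internal : Set ℂ) ∪ (⋃ f ∈ {f | f ≠ e}, Γ.edgeSet f) ∪
    γ '' (Icc 0 1 \ Ioo (t₀ - η) (t₀ + η)) with hK
  have hKc : IsClosed K := by
    refine (Γ.internal.finite_toSet.isClosed.union ?_).union ?_
    · exact (toFinite _).isClosed_biUnion fun f _ => Γ.isClosed_edgeSet f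
    · exact ((isCompact_Icc.diff isOpen_Ioo).image hγc).isClosed
  have hKn : γ t₀ ∉ K := by
    rintro ((hv | hf) | ⟨t, ht, hte⟩)
    · exact (Γ.arc_mem e t₀ ht₀).2 hv
    · simp only [mem_iUnion] at hf
      obtain ⟨f, hfe, hf⟩ := hf
      rcases Γ.mem_edgeSet_cases hf (Γ.arc_mem e t₀ ht₀).1 with hv | ⟨s, hs, hse⟩
      · exact (Γ.arc_mem e t₀ ht₀).2 hv
      · exact hfe (Γ.arc_inj f e s hs t₀ ht₀ hse).1
    · have hm : γ t ∈ Γ.edgeSet e := ⟨t, ht.1, rfl⟩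
      rcases Γ.mem_edgeSet_cases hm (hte ▸ (Γ.arc_mem e t₀ ht₀).1) with hv | _
      · exact (Γ.arc_mem e t₀ ht₀).2 (show γ t₀ ∈ _ from hte ▸ hv)
      · have hin : t ∈ Ioo (0 : ℝ) 1 := by
          rcases eq_or_lt_of_le ht.1.1 with h0 | h0
          · exfalso
            rcases Γ.endpoint_cases e false with h | h
            · refine (Γ.arc_mem e t₀ ht₀).2 ?_
              rw [← hγ, ← hte, ← h0]
              exact h
            · refine h ?_
              have := (Γ.arc_mem e t₀ ht₀).1
              rw [← hγ, ← hte, ← h0] at this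
              exact this
          rcases eq_or_lt_of_le ht.1.2 with h1 | h1
          · exfalso
            rcases Γ.endpoint_cases e true with h | h
            · refine (Γ.arc_mem e t₀ ht₀).2 ?_
              rw [← hγ, ← hte, h1]
              exact h
            · refine h ?_
              have := (Γ.arc_mem e t₀ ht₀).1
              rw [← hγ, ← hte, h1] at this
              exact this
          exact ⟨h0, h1⟩
        have := (Γ.arc_inj e e t hin t₀ ht₀ hte).2
        exact ht.2 (by rw [this]; constructor <;> linarith)
  set Φ : ℝ × ℝ → ℂ := fun p => γ p.1 + p.2 * (Complex.I * d) with hΦ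
  have hΦc : Continuous Φ := by
    have : Continuous fun p : ℝ × ℝ => γ p.1 := hγc.comp continuous_fst
    have h2 : Continuous fun p : ℝ × ℝ => ((p.2 : ℝ) : ℂ) :=
      Complex.continuous_ofReal.comp continuous_snd
    exact this.add (h2.mul continuous_const)
  have hΦd : ∀ p, Φ p / d = γ p.1 / d + p.2 * Complex.I := by
    intro p
    simp only [hΦ]
    field_simp
  have hΦre : ∀ p, (Φ p / d).re = a p.1 := by
    intro p
    rw [hΦd]
    simp [ha]
  have hN : Φ ⁻¹' (openRect \ K) ∈ 𝓝 (t₀, (0 : ℝ)) := by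
    refine ((isOpen_openRect.sdiff hKc).preimage hΦc).mem_nhds ?_
    simp only [mem_preimage, hΦ, Complex.ofReal_zero, zero_mul, add_zero]
    exact ⟨(Γ.arc_mem e t₀ ht₀).1, hKn⟩
  obtain ⟨δ, hδ, hδb⟩ := Metric.mem_nhds_iff.1 hN
  rw [← ball_prod_same, Real.ball_eq_Ioo, Real.ball_eq_Ioo] at hδb
  set ε := min δ η with hε
  have hε0 : 0 < ε := lt_min hδ hη
  have hεδ : ε ≤ δ := min_le_left _ _
  have hεη : ε ≤ η := min_le_right _ _
  have hgood : ∀ τ ∈ Ioo (t₀ - ε) (t₀ + ε), ∀ s ∈ Ioo (-ε) ε, s ≠ 0 → Φ (τ, s) ∈ Γ.compl := by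
    intro τ hτ s hs hs0
    have hmem : Φ (τ, s) ∈ openRect \ K :=
      hδb ⟨⟨by linarith [hτ.1], by linarith [hτ.2]⟩, by constructor <;> linarith [hs.1, hs.2]⟩
    refine ⟨hmem.1, ?_⟩
    rintro (hv | hf)
    · exact hmem.2 (Or.inl (Or.inl hv))
    · obtain ⟨f, hf⟩ := mem_iUnion.1 hf
      by_cases hfe : f = e
      · subst hfe
        obtain ⟨τ', hτ', hte⟩ := hf
        by_cases hin : τ' ∈ Ioo (t₀ - η) (t₀ + η)
        · have h1 : a τ' = a τ := by
            have := hΦre (τ, s)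
            rw [← hte] at this
            exact this
          have h2 : τ' = τ := hmono.injOn hin
            ⟨by linarith [hτ.1], by linarith [hτ.2]⟩ h1
          rw [h2] at hte
          have h3 : (s : ℂ) * (Complex.I * d) = 0 := by
            have : γ τ = γ τ + s * (Complex.I * d) := hte
            simpa using this.symm
          have h4 : (s : ℂ) = 0 := by
            rcases mul_eq_zero.1 h3 with h | h
            · exact h
            · exact absurd h (mul_ne_zero Complex.I_ne_zero hd0)
          exact hs0 (by exact_mod_cast h4)
        · exact hmem.2 (Or.inr ⟨τ', ⟨hτ', hin⟩, hte⟩)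
      · refine hmem.2 (Or.inl (Or.inr ?_))
        simp only [mem_iUnion]
        exact ⟨f, hfe, hf⟩
  refine ⟨Φ '' (Ioo (t₀ - ε) (t₀ + ε) ×ˢ Ioo 0 ε), Φ '' (Ioo (t₀ - ε) (t₀ + ε) ×ˢ Ioo (-ε) 0),
    (isPreconnected_Ioo.prod isPreconnected_Ioo).image _ hΦc.continuousOn,
    (isPreconnected_Ioo.prod isPreconnected_Ioo).image _ hΦc.continuousOn, ?_, ?_, ?_, ?_⟩
  · rintro _ ⟨⟨τ, s⟩, ⟨hτ, hs⟩, rfl⟩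
    exact hgood τ hτ s ⟨by linarith [hs.1], hs.2⟩ hs.1.ne'
  · rintro _ ⟨⟨τ, s⟩, ⟨hτ, hs⟩, rfl⟩
    exact hgood τ hτ s ⟨hs.1, by linarith [hs.2]⟩ hs.2.ne
  · have hbn : ∀ᶠ t in 𝓝 t₀, |b t - b t₀| < ε / 2 := by
      have : Tendsto (fun t => |b t - b t₀|) (𝓝 t₀) (𝓝 |b t₀ - b t₀|) :=
        ((hbc.sub continuous_const).abs).continuousAt
      rw [sub_self, abs_zero] at this
      exact this.eventually (gt_mem_nhds (by linarith))
    obtain ⟨ρ, hρ, hρb⟩ := Metric.eventually_nhds_iff_ball.1 hbn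
    rw [Real.ball_eq_Ioo] at hρb
    set κ := min ρ ε / 2 with hκ
    have hκ0 : 0 < κ := by have := lt_min hρ hε0; simp only [hκ]; linarith
    have hκρ : κ < ρ := by have := min_le_left ρ ε; simp only [hκ]; linarith
    have hκε : κ < ε := by have := min_le_right ρ ε; simp only [hκ]; linarith
    refine ⟨{z | (z / d).re ∈ Ioo (a (t₀ - κ)) (a (t₀ + κ)) ∧ |(z / d).im - b t₀| < ε / 2},
      ?_, ?_⟩
    · refine IsOpen.mem_nhds ?_ ?_
      · have h1 : Continuous fun z : ℂ => (z / d).re :=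
          Complex.continuous_re.comp (continuous_id.div_const d)
        have h2 : Continuous fun z : ℂ => |(z / d).im - b t₀| :=
          ((Complex.continuous_im.comp (continuous_id.div_const d)).sub continuous_const).abs
        exact (isOpen_Ioo.preimage h1).inter (isOpen_Iio.preimage h2)
      · refine ⟨⟨?_, ?_⟩, ?_⟩
        · exact hmono ⟨by linarith, by linarith⟩ ⟨by linarith, by linarith⟩ (by linarith)
        · exact hmono ⟨by linarith, by linarith⟩ ⟨by linarith, by linarith⟩ (by linarith)
        · simp only [hb, sub_self, abs_zero]
          linarith
    · rintro z ⟨⟨hz1, hz2⟩, hzc⟩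
      obtain ⟨τ, hτ, hτz⟩ := intermediate_value_Icc (by linarith : t₀ - κ ≤ t₀ + κ)
        hac.continuousOn ⟨hz1.1.le, hz1.2.le⟩
      set s := (z / d).im - b τ with hs
      have hb1 := abs_lt.1 (hρb τ ⟨by linarith [hτ.1], by linarith [hτ.2]⟩)
      have hb2 := abs_lt.1 hz2
      have hzΦ : Φ (τ, s) = z := by
        have h : Φ (τ, s) / d = z / d := by
          rw [hΦd]
          apply Complex.ext
          · simpa [ha] using hτz
          · simp [hs, hb]
        exact (div_left_inj' hd0).1 h
      have hτ' : τ ∈ Ioo (t₀ - ε) (t₀ + ε) := ⟨by linarith [hτ.1], by linarith [hτ.2]⟩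
      rcases lt_trichotomy s 0 with h | h | h
      · right
        exact ⟨(τ, s), ⟨hτ', ⟨by linarith, h⟩⟩, hzΦ⟩
      · exfalso
        have h01 := (hball τ ⟨by linarith [hτ'.1], by linarith [hτ'.2]⟩).2
        refine hzc.2 (Or.inr (mem_iUnion.2 ⟨e, τ, ⟨h01.1.le, h01.2.le⟩, ?_⟩))
        rw [← hzΦ, h]
        simp [hΦ, hγ]
      · left
        exact ⟨(τ, s), ⟨hτ', ⟨h, by linarith⟩⟩, hzΦ⟩
  · filter_upwards [Ioo_mem_nhds (by linarith : t₀ - ε < t₀) (by linarith : t₀ < t₀ + ε)]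
      with t ht
    have hΦt : γ t = Φ (t, 0) := by simp [hΦ]
    constructor
    · rw [hΦt]
      refine image_closure_subset_closure_image hΦc ⟨(t, 0), ?_, rfl⟩
      rw [closure_prod_eq, closure_Ioo (a := (0 : ℝ)) hε0.ne]
      exact ⟨subset_closure ht, le_rfl, hε0.le⟩
    · rw [hΦt]
      refine image_closure_subset_closure_image hΦc ⟨(t, 0), ?_, rfl⟩
      rw [closure_prod_eq, closure_Ioo (a := -ε) (b := (0 : ℝ)) (by linarith)]
      exact ⟨subset_closure ht, by linarith, le_rfl⟩

theorem Face.isOpen (F : Γ.Face) : IsOpen F.1 := by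
  obtain ⟨F, p, hp, rfl⟩ := F
  exact Γ.isOpen_compl.connectedComponentIn

theorem Face.subset_compl (F : Γ.Face) : F.1 ⊆ Γ.compl := by
  obtain ⟨F, p, hp, rfl⟩ := F
  exact connectedComponentIn_subset _ _

theorem Face.nonempty (F : Γ.Face) : F.1.Nonempty := by
  obtain ⟨F, p, hp, rfl⟩ := F
  exact ⟨p, mem_connectedComponentIn hp⟩

theorem Face.eq_component (F : Γ.Face) {q : ℂ} (hq : q ∈ F.1) :
    F.1 = connectedComponentIn Γ.compl q := by
  obtain ⟨F, p, hp, rfl⟩ := F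
  exact connectedComponentIn_eq hq

theorem Face.subset_of_isPreconnected (F : Γ.Face) {A : Set ℂ} (hA : IsPreconnected A)
    (hAc : A ⊆ Γ.compl) {q : ℂ} (hq : q ∈ F.1) (hqA : q ∈ A) : A ⊆ F.1 := by
  rw [F.eq_component Γ hq]
  exact hA.subset_connectedComponentIn hqA hAc

theorem Face.closure_inter (F : Γ.Face) : closure F.1 ∩ Γ.compl ⊆ F.1 := by
  rintro z ⟨hz, hzc⟩
  have ho : IsOpen (connectedComponentIn Γ.compl z) := Γ.isOpen_compl.connectedComponentIn
  obtain ⟨q, hq1, hq2⟩ := mem_closure_iff.1 hz _ ho (mem_connectedComponentIn hzc)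
  rw [F.eq_component Γ hq2, ← connectedComponentIn_eq hq1]
  exact mem_connectedComponentIn hzc

theorem Face.touches_middle (F : Γ.Face) (e : Γ.Edge) {t : ℝ} (ht : t ∈ Ioo (0 : ℝ) 1)
    (h : Γ.arc e t ∈ closure F.1) : Γ.arc e (1 / 2) ∈ closure F.1 := by
  have hs : Ioo (0 : ℝ) 1 ⊆ {s ∈ Ioo (0 : ℝ) 1 | Γ.arc e s ∈ closure F.1} := by
    refine isPreconnected_Ioo.subset_of_closure_inter_subset ?_ ⟨t, ht, ht, h⟩ ?_
    · rw [isOpen_iff_mem_nhds]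
      rintro s ⟨hs, hsF⟩
      obtain ⟨A, B, hA, hB, hAc, hBc, ⟨W, hW, hWAB⟩, hcl⟩ := Γ.exists_strips e s hs
      obtain ⟨q, hqW, hqF⟩ := mem_closure_iff_nhds.1 hsF W hW
      filter_upwards [hcl, isOpen_Ioo.mem_nhds hs] with r hr hr'
      refine ⟨hr', ?_⟩
      rcases hWAB ⟨hqW, F.subset_compl Γ hqF⟩ with hq | hq
      · exact closure_mono (F.subset_of_isPreconnected Γ hA hAc hqF hq) hr.1
      · exact closure_mono (F.subset_of_isPreconnected Γ hB hBc hqF hq) hr.2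
    · rintro s ⟨hs, hs'⟩
      refine ⟨hs', ?_⟩
      have hcl : IsClosed {r | Γ.arc e r ∈ closure F.1} :=
        isClosed_closure.preimage (Γ.arc_contDiff e).continuous
      exact closure_minimal (fun r hr => hr.2) hcl hs
  exact (hs (by norm_num : (1 / 2 : ℝ) ∈ Ioo (0 : ℝ) 1)).2

theorem Face.eq_of_not_touches (F : Γ.Face)
    (h : ∀ e, ∀ t ∈ Ioo (0 : ℝ) 1, Γ.arc e t ∉ closure F.1) :
    F.1 = openRect \ (↑Γ.internal : Set ℂ) := by
  refine Subset.antisymm ?_ ?_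
  · intro z hz
    have := F.subset_compl Γ hz
    exact ⟨this.1, fun hv => this.2 (Or.inl hv)⟩
  · refine (isPreconnected_openRect_diff _ Γ.internal.finite_toSet).subset_of_closure_inter_subset
      (F.isOpen Γ) ?_ ?_
    · obtain ⟨z, hz⟩ := F.nonempty Γ
      have := F.subset_compl Γ hz
      exact ⟨z, ⟨this.1, fun hv => this.2 (Or.inl hv)⟩, hz⟩
    · rintro z ⟨hz, hzr, hzv⟩
      refine F.closure_inter Γ ⟨hz, hzr, ?_⟩
      rintro (hv | he)
      · exact hzv hv
      · obtain ⟨e, he⟩ := mem_iUnion.1 he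
        rcases Γ.mem_edgeSet_cases he hzr with hv | ⟨t, ht, rfl⟩
        · exact hzv hv
        · exact h e t ht hz

instance : Finite Γ.Face := by
  have hmid : (1 / 2 : ℝ) ∈ Ioo (0 : ℝ) 1 := by norm_num
  choose A B hA hB hAc hBc hW hcl using fun e => Γ.exists_strips e (1 / 2) hmid
  have hAne : ∀ e, (A e).Nonempty := fun e => closure_nonempty_iff.1 ⟨_, (hcl e).self_of_nhds.1⟩
  have hBne : ∀ e, (B e).Nonempty := fun e => closure_nonempty_iff.1 ⟨_, (hcl e).self_of_nhds.2⟩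
  choose a ha using hAne
  choose b hb using hBne
  have hfin : (insert (openRect \ (↑Γ.internal : Set ℂ))
      ((range fun e => connectedComponentIn Γ.compl (a e)) ∪
        (range fun e => connectedComponentIn Γ.compl (b e)))).Finite :=
    ((finite_range _).union (finite_range _)).insert _
  refine Set.Finite.to_subtype (s := {F : Set ℂ | ∃ p ∈ Γ.compl, F = connectedComponentIn Γ.compl p})
    (hfin.subset ?_)
  intro F' hF'
  set F : Γ.Face := ⟨F', hF'⟩ with hFdef
  by_cases ht : ∃ e, ∃ t ∈ Ioo (0 : ℝ) 1, Γ.arc e t ∈ closure F.1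
  · obtain ⟨e, t, ht, hte⟩ := ht
    have hm := F.touches_middle Γ e ht hte
    obtain ⟨W, hWn, hWAB⟩ := hW e
    obtain ⟨q, hqW, hqF⟩ := mem_closure_iff_nhds.1 hm W hWn
    right
    rcases hWAB ⟨hqW, F.subset_compl Γ hqF⟩ with hq | hq
    · left
      exact ⟨e, (F.eq_component Γ
        (F.subset_of_isPreconnected Γ (hA e) (hAc e) hqF hq (ha e))).symm⟩
    · right
      exact ⟨e, (F.eq_component Γ
        (F.subset_of_isPreconnected Γ (hB e) (hBc e) hqF hq (hb e))).symm⟩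
  · push Not at ht
    left
    exact F.eq_of_not_touches Γ ht

instance : Fintype Γ.Face := Fintype.ofFinite _

end PlabicGraph

/-! ### The dual quiver and the log-canonical bracket -/

namespace PlabicGraph

open scoped ComplexConjugate

variable {n : ℕ} (Γ : PlabicGraph n)

/-- The face `F` lies along the edge `e` on its left (with respect to the direction of `arc e`). -/
def LeftOf (e : Γ.Edge) (F : Γ.Face) : Prop :=
  ∀ t ∈ Ioo (0 : ℝ) 1, ∀ᶠ s : ℝ in 𝓝[>] 0,
    Γ.arc e t + s * (Complex.I * deriv (Γ.arc e) t) ∈ F.1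

/-- The face `F` lies along the edge `e` on its right. -/
def RightOf (e : Γ.Edge) (F : Γ.Face) : Prop :=
  ∀ t ∈ Ioo (0 : ℝ) 1, ∀ᶠ s : ℝ in 𝓝[>] 0,
    Γ.arc e t - s * (Complex.I * deriv (Γ.arc e) t) ∈ F.1

/-- The vertices `u`, `v` are joined by an edge that has a dual arrow, and `u` plays the role of
the black endpoint, `v` that of the white one: they are black and white, or black and a boundary
vertex, or a boundary vertex and white. -/
def BlackToWhite (u v : ℂ) : Prop :=
  (u ∈ Γ.black ∧ v ∉ Γ.black) ∨ (u ∉ Γ.white ∧ v ∈ Γ.white)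

/-- The edge `e` has a dual arrow (or half-arrow), which goes from `F` to `G`: it crosses `e` with
the white endpoint of `e` (if there is one) on its left and the black one on its right. -/
def Arrow (e : Γ.Edge) (F G : Γ.Face) : Prop :=
  (Γ.BlackToWhite (Γ.endpoint e false) (Γ.endpoint e true) ∧ Γ.LeftOf e F ∧ Γ.RightOf e G) ∨
  (Γ.BlackToWhite (Γ.endpoint e true) (Γ.endpoint e false) ∧ Γ.RightOf e F ∧ Γ.LeftOf e G)

open Classical in
/-- The number of arrows from `F` to `G` in the dual quiver: an arrow dual to an edge with two
internal endpoints counts as `1`, one dual to an edge with a boundary endpoint as `1 / 2`. -/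
def arrows (F G : Γ.Face) : ℚ :=
  ∑ e, if Γ.Arrow e F G then (if ∀ b, Γ.endpoint e b ∈ Γ.internal then 1 else 1 / 2) else 0

/-- The skew-symmetric adjacency matrix of the dual quiver. -/
def q (F G : Γ.Face) : ℚ := Γ.arrows F G - Γ.arrows G F

/-- The log-canonical bracket `{y_i, y_j} = q_ij y_i y_j`, as a biderivation. -/
def bracket (f g : (Γ.Face → ℂ) → ℂ) (y : Γ.Face → ℂ) : ℂ := by
  classical
  exact ∑ i, ∑ j, (Γ.q i j : ℂ) * y i * y j *
    fderiv ℂ f y (Pi.single i 1) * fderiv ℂ g y (Pi.single j 1)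

/-- The space of face weightings. -/
def weightings : Set (Γ.Face → ℂ) := {y | (∀ i, y i ≠ 0) ∧ ∏ i, y i = 1}

/-! ### Square moves along the midline, and move-symmetry -/

/-- The vertices of the graph on the boundary of a face. -/
def corners (F : Γ.Face) : Set ℂ := {v | (∃ e b, Γ.endpoint e b = v) ∧ v ∈ frontier F.1}

/-- The face `F` is a square on the midline, with two opposite vertices on the midline: it meets
the midline, and its boundary is a cycle of four edges with four different vertices, each of which
has `F` on exactly one side. -/
def IsMidSquare (F : Γ.Face) : Prop :=
  (∃ p ∈ F.1, p.im = 0) ∧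
  ∃ (v : Fin 4 → ℂ) (e : Fin 4 → Γ.Edge), Function.Injective v ∧
    (∀ i, (Γ.endpoint (e i) false = v i ∧ Γ.endpoint (e i) true = v (i + 1)) ∨
      (Γ.endpoint (e i) true = v i ∧ Γ.endpoint (e i) false = v (i + 1))) ∧
    frontier F.1 = ⋃ i, Γ.edgeSet (e i) ∧
    (∀ i, Xor (Γ.LeftOf (e i) F) (Γ.RightOf (e i) F)) ∧
    (v 0).im = 0 ∧ (v 2).im = 0

/-- A square move can be performed at the square face `F`: its vertices are trivalent and their
colours alternate. -/
def IsMovable (F : Γ.Face) : Prop :=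
  (∀ v ∈ Γ.corners F, Γ.degree v = 3) ∧
  ∀ e, Γ.edgeSet e ⊆ frontier F.1 →
    (Γ.endpoint e false ∈ Γ.black ∧ Γ.endpoint e true ∈ Γ.white) ∨
    (Γ.endpoint e false ∈ Γ.white ∧ Γ.endpoint e true ∈ Γ.black)

/-- The vertices of the squares on the midline. -/
def squareVertices : Set ℂ := ⋃ F ∈ {F | Γ.IsMidSquare F}, Γ.corners F

/-- The black vertices after the square moves at all squares on the midline. A square move changes
the colours of the vertices of the square. -/
def movedBlack : Set ℂ := (↑Γ.black \ Γ.squareVertices) ∪ (↑Γ.white ∩ Γ.squareVertices)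

/-- The white vertices after the square moves at all squares on the midline. -/
def movedWhite : Set ℂ := (↑Γ.white \ Γ.squareVertices) ∪ (↑Γ.black ∩ Γ.squareVertices)

/-- The plabic graph is move-symmetric: the square moves at all squares on the midline (with two
opposite vertices on the midline) can be performed (independently of each other), and reflecting
the resulting graph in the midline gives the initial graph with opposite colours of vertices. -/
structure IsMoveSymmetric : Prop where
  movable : ∀ F, Γ.IsMidSquare F → Γ.IsMovable F
  independent : ∀ F G, Γ.IsMidSquare F → Γ.IsMidSquare G → F ≠ G →
    Disjoint (Γ.corners F) (Γ.corners G)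
  left_symm : ∀ i, Γ.leftHt i.rev = -Γ.leftHt i
  right_symm : ∀ i, Γ.rightHt i.rev = -Γ.rightHt i
  edge_symm : ∀ e, ∃ f, Γ.edgeSet f = conj '' Γ.edgeSet e
  movedBlack_symm : conj '' Γ.movedBlack = ↑Γ.white
  movedWhite_symm : conj '' Γ.movedWhite = ↑Γ.black

open Classical in
/-- The effect on face weights of the square moves at all squares on the midline. The weight of
such a square is inverted; for every arrow between another face `i` and such a square `k` the
weight of `i` is multiplied by `1 + y_k` if the arrow goes from `i` to `k`, and by
`(1 + y_k⁻¹)⁻¹` if it goes from `k` to `i`. -/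
def squareMoves (y : Γ.Face → ℂ) (i : Γ.Face) : ℂ :=
  if Γ.IsMidSquare i then (y i)⁻¹
  else y i * ∏ k with Γ.IsMidSquare k, ∏ e,
    ((if Γ.Arrow e i k then 1 + y k else 1) * (if Γ.Arrow e k i then (1 + (y k)⁻¹)⁻¹ else 1))

/-- The domain in the torus of all `y` on which the square moves are defined. -/
def domain : Set (Γ.Face → ℂ) := {y | (∀ i, y i ≠ 0) ∧ ∀ k, Γ.IsMidSquare k → 1 + y k ≠ 0}

variable {Γ}

theorem conj_mem_openRect {z : ℂ} : conj z ∈ openRect ↔ z ∈ openRect := by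
  simp only [openRect, Complex.mem_reProdIm, Complex.conj_re, Complex.conj_im, mem_Ioo]
  constructor <;> rintro ⟨h1, h2, h3⟩ <;> exact ⟨h1, by linarith, by linarith⟩

theorem IsMoveSymmetric.conj_mem_carrier (hΓ : Γ.IsMoveSymmetric) {z : ℂ}
    (hz : z ∈ Γ.carrier) : conj z ∈ Γ.carrier := by
  rcases hz with hz | hz
  · left
    have hz' : z ∈ Γ.black ∨ z ∈ Γ.white := by simpa [internal] using hz
    have hm : z ∈ Γ.movedBlack ∨ z ∈ Γ.movedWhite := by
      by_cases hs : z ∈ Γ.squareVertices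
      · rcases hz' with h | h
        · exact Or.inr (Or.inr ⟨h, hs⟩)
        · exact Or.inl (Or.inr ⟨h, hs⟩)
      · rcases hz' with h | h
        · exact Or.inl (Or.inl ⟨h, hs⟩)
        · exact Or.inr (Or.inl ⟨h, hs⟩)
    have : conj z ∈ Γ.white ∨ conj z ∈ Γ.black := by
      rcases hm with h | h
      · left
        have := hΓ.movedBlack_symm ▸ mem_image_of_mem conj h
        exact this
      · right
        have := hΓ.movedWhite_symm ▸ mem_image_of_mem conj h
        exact this
    simpa [internal] using this.symm
  · right
    obtain ⟨e, he⟩ := mem_iUnion.1 hz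
    obtain ⟨f, hf⟩ := hΓ.edge_symm e
    exact mem_iUnion.2 ⟨f, hf ▸ mem_image_of_mem conj he⟩

theorem IsMoveSymmetric.image_compl (hΓ : Γ.IsMoveSymmetric) : conj '' Γ.compl = Γ.compl := by
  have h : ∀ z ∈ Γ.compl, conj z ∈ Γ.compl := by
    rintro z ⟨hz, hzc⟩
    refine ⟨conj_mem_openRect.2 hz, fun h => hzc ?_⟩
    simpa using hΓ.conj_mem_carrier h
  refine Subset.antisymm ?_ ?_
  · rintro _ ⟨z, hz, rfl⟩
    exact h z hz
  · intro z hz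
    exact ⟨conj z, h z hz, by simp⟩

/-- The face `i'` symmetric to the face `i` with respect to the midline. -/
def IsMoveSymmetric.mirror (hΓ : Γ.IsMoveSymmetric) (i : Γ.Face) : Γ.Face :=
  ⟨conj '' i.1, by
    obtain ⟨F, p, hp, rfl⟩ := i
    refine ⟨conj p, ?_, ?_⟩
    · rw [← hΓ.image_compl]
      exact mem_image_of_mem _ hp
    · have := Complex.conjCLE.toHomeomorph.image_connectedComponentIn hp
      have h2 : (Complex.conjCLE.toHomeomorph : ℂ → ℂ) '' Γ.compl = Γ.compl := hΓ.image_compl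
      rw [h2] at this
      exact this⟩

/-- The involution `σ` on face weights: square moves at all squares on the midline, followed by
reflection in the midline. -/
def IsMoveSymmetric.sigma (hΓ : Γ.IsMoveSymmetric) (y : Γ.Face → ℂ) (i : Γ.Face) : ℂ :=
  Γ.squareMoves y (hΓ.mirror i)

/-- The space of move-symmetric face weightings. -/
def IsMoveSymmetric.msWeightings (hΓ : Γ.IsMoveSymmetric) : Set (Γ.Face → ℂ) :=
  {y | y ∈ Γ.weightings ∧ y ∈ Γ.domain ∧ hΓ.sigma y = y}

/-! ### The induced bracket on the space of move-symmetric weightings -/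

/-- `F` is an extension of the function `f` on the space of move-symmetric weightings to a
`σ`-invariant function on the space of all weightings (without the indeterminacy locus of `σ`).
Functions on the latter space are restrictions of holomorphic functions of the coordinates `y`. -/
structure IsMoveSymmetric.IsInvariantExtension (hΓ : Γ.IsMoveSymmetric)
    (f : hΓ.msWeightings → ℂ) (F : (Γ.Face → ℂ) → ℂ) : Prop where
  differentiableOn : DifferentiableOn ℂ F Γ.domain
  invariant : ∀ y ∈ Γ.weightings, y ∈ Γ.domain → F (hΓ.sigma y) = F y
  extends_f : ∀ y : hΓ.msWeightings, F y = f y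

/-- `h` is the induced Poisson bracket of the functions `f`, `g` on the space of move-symmetric
weightings: `f` and `g` have `σ`-invariant extensions, and for all such extensions `h` is the
restriction of their bracket. -/
def IsMoveSymmetric.IsInducedBracket (hΓ : Γ.IsMoveSymmetric)
    (f g h : hΓ.msWeightings → ℂ) : Prop :=
  (∃ F, hΓ.IsInvariantExtension f F) ∧ (∃ G, hΓ.IsInvariantExtension g G) ∧
  ∀ F G, hΓ.IsInvariantExtension f F → hΓ.IsInvariantExtension g G →
    ∀ y : hΓ.msWeightings, h y = Γ.bracket F G y

/-- The face `i` lies above the midline. -/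
def IsUpper (i : Γ.Face) : Prop := ∀ p ∈ i.1, 0 < p.im

/-- The numbers `c_i > 0`, for faces `i` above the midline, are the constants with
`y_{i'} = c_i y_i` for all move-symmetric weightings. -/
def IsMoveSymmetric.IsMirrorRatio (hΓ : Γ.IsMoveSymmetric) (c : Γ.Face → ℝ) : Prop :=
  ∀ i, IsUpper i → 0 < c i ∧ ∀ y ∈ hΓ.msWeightings, y (hΓ.mirror i) = c i * y i

/-- The function `√(y_i y_{i'}) := √c_i y_i` on the space of move-symmetric weightings. -/
def IsMoveSymmetric.geomMean (hΓ : Γ.IsMoveSymmetric) (c : Γ.Face → ℝ) (i : Γ.Face)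
    (y : hΓ.msWeightings) : ℂ := (Real.sqrt (c i) : ℂ) * y.1 i

end PlabicGraph

end

open scoped ComplexConjugate

noncomputable section

namespace PlabicGraph

variable {n : ℕ} {Γ : PlabicGraph n}

/-! ### The two sides of an edge -/

/-! At a fixed point of `σ`, the differential of an invariant function is almost forced, and the
remaining freedom is invisible to the bracket.

On a move-symmetric weighting every square `k` used in the moves satisfies `y_k = y_k⁻¹` with `y_k ≠
-1`, so `y_k = 1`. The factors of the square moves are then powers of 2 and the ratio of `y_i` to
`y_{i'}` is constant (`eq_ratio_mul`). Averaging `√c_i y_i` with its pullback under `σ` gives an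
invariant extension.

Now let `F` be any invariant extension of `f = √c_i y_i`. In logarithmic coordinates take a vector
`v` with `∑ v_a = 0`. Invariance gives `dF(dσ v) = dF(v)`, so `dF(v) = ½ dF(v + dσ v)`. The vector
`v + dσ v` is tangent to the fixed point set, where `F = f` (`fderiv_invariantExtension`). Hence
`dF` is `½ f` times the covector `meanCovector`, up to a multiple of the all-ones covector `d(∑ log
y_a)` (`exists_fderiv_eq`). That multiple does not matter because the rows of `q` sum to zero
(`sum_q_eq_zero`).

The covector is `e_i + e_{i'}` plus terms at the squares, so pairing two of them through `q` gives
`q_ij + q_{i'j'}`, the mixed terms `q_{ij'} + q_{i'j}`, and square terms. The square terms vanish: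
vertices of squares keep their colours under reflection, so reflection reverses the arrows at
squares (`arrow_mirrorEdge`) and `q_ik + q_{i'k} = 0`; two squares have no arrows between them. The
mixed terms cancel: an edge separating an upper face from a lower one lies on the midline, so the
two faces are mirror images, and then skew-symmetry applies (`q_mirror_add`). The two factors `½`
give `¼`.

The rest is plane topology: each side of an edge belongs to a single face, a mirror image of an edge
is an edge with sides and direction under control (`mirrorEdge_cases`), and a small circle around a
vertex crosses each half-edge there once, from its right to its left (`sum_outgoingLeft_eq_zero`).
The last fact, weighted by vertex colours, yields the zero row sums. -/

theorem mem_Ioo_of_arc_mem (e : Γ.Edge) {t : ℝ} (ht : t ∈ Icc (0 : ℝ) 1)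
    (h : Γ.arc e t ∈ openRect) (h' : Γ.arc e t ∉ Γ.internal) : t ∈ Ioo (0 : ℝ) 1 := by
  refine ⟨lt_of_le_of_ne ht.1 ?_, lt_of_le_of_ne ht.2 ?_⟩
  · rintro rfl
    rcases Γ.endpoint_cases e false with h1 | h1
    · exact h' h1
    · exact h1 h
  · rintro rfl
    rcases Γ.endpoint_cases e true with h1 | h1
    · exact h' h1
    · exact h1 h

/-- A point of the open rectangle that is not a vertex is on at most one edge. -/
theorem eq_of_arc_eq {e f : Γ.Edge} {s t : ℝ} (hs : s ∈ Ioo (0 : ℝ) 1) (ht : t ∈ Icc (0 : ℝ) 1)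
    (h : Γ.arc f t = Γ.arc e s) : f = e ∧ t = s := by
  have hm := Γ.arc_mem e s hs
  refine Γ.arc_inj f e t ?_ s hs h
  exact mem_Ioo_of_arc_mem f ht (h ▸ hm.1) (h ▸ hm.2)

/-- Near an inner point of an edge, the graph consists of a small part of the edge. -/
theorem exists_ball_inter_carrier (e : Γ.Edge) {t₀ : ℝ} (ht₀ : t₀ ∈ Ioo (0 : ℝ) 1) {η : ℝ}
    (hη : 0 < η) : ∃ δ > 0, ∀ z, ‖z - Γ.arc e t₀‖ < δ → z ∈ openRect ∧
      (z ∈ Γ.carrier → ∃ u, |u - t₀| < η ∧ Γ.arc e u = z) := by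
  -- `K` is the graph without the piece of `e` with parameters within `η` of `t₀`; it is closed and
  -- misses the point, so a ball around the point avoids it.
  set K : Set ℂ := (↑Γ.internal : Set ℂ) ∪ (⋃ f ∈ {f | f ≠ e}, Γ.edgeSet f) ∪
    Γ.arc e '' (Icc 0 1 \ Metric.ball t₀ η) with hK
  have hKc : IsClosed K := by
    refine (Γ.internal.finite_toSet.isClosed.union ?_).union ?_
    · exact (toFinite _).isClosed_biUnion fun f _ => Γ.isClosed_edgeSet f
    · exact ((isCompact_Icc.diff Metric.isOpen_ball).image (Γ.arc_contDiff e).continuous).isClosed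
  have hKn : Γ.arc e t₀ ∉ K := by
    rintro ((hv | hf) | ⟨t, ht, hte⟩)
    · exact (Γ.arc_mem e t₀ ht₀).2 hv
    · simp only [mem_iUnion] at hf
      obtain ⟨f, hfe, s, hs, hf⟩ := hf
      exact hfe (eq_of_arc_eq ht₀ hs hf).1
    · refine ht.2 ?_
      rw [(eq_of_arc_eq ht₀ ht.1 hte).2]
      exact Metric.mem_ball_self hη
  obtain ⟨δ, hδ, hb⟩ := Metric.isOpen_iff.1 (isOpen_openRect.sdiff hKc) _
    ⟨(Γ.arc_mem e t₀ ht₀).1, hKn⟩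
  refine ⟨δ, hδ, fun z hz => ?_⟩
  have hz' := hb (mem_ball_iff_norm.2 hz)
  refine ⟨hz'.1, ?_⟩
  rintro (hv | hf)
  · exact absurd (Or.inl (Or.inl hv)) hz'.2
  · obtain ⟨f, hf⟩ := mem_iUnion.1 hf
    by_cases hfe : f = e
    · subst hfe
      obtain ⟨u, hu, rfl⟩ := hf
      refine ⟨u, ?_, rfl⟩
      by_contra hc
      exact hz'.2 (Or.inr ⟨u, ⟨hu, by rwa [Metric.mem_ball, Real.dist_eq]⟩, rfl⟩)
    · refine absurd (Or.inl (Or.inr ?_)) hz'.2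
      simp only [mem_iUnion]
      exact ⟨f, hfe, hf⟩

theorem continuous_deriv_arc (e : Γ.Edge) : Continuous (deriv (Γ.arc e)) :=
  (Γ.arc_contDiff e).continuous_deriv le_rfl

theorem hasDerivAt_arc (e : Γ.Edge) (t : ℝ) : HasDerivAt (Γ.arc e) (deriv (Γ.arc e) t) t :=
  ((Γ.arc_contDiff e).differentiable one_ne_zero t).hasDerivAt

/-- Near an inner point of an edge, the normals to the edge do not meet the graph again. -/
theorem exists_normals_subset_compl (e : Γ.Edge) {t₀ : ℝ} (ht₀ : t₀ ∈ Ioo (0 : ℝ) 1) :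
    ∃ η > 0, ∀ t, |t - t₀| < η → ∀ s : ℝ, |s| < η → s ≠ 0 →
      Γ.arc e t + s * (Complex.I * deriv (Γ.arc e) t) ∈ Γ.compl := by
  set γ := Γ.arc e with hγ
  set d := deriv γ t₀ with hd
  have hd0 : 0 < ‖d‖ := norm_pos_iff.2 (Γ.arc_regular e t₀ ⟨ht₀.1.le, ht₀.2.le⟩)
  have hstrict : HasStrictDerivAt γ d t₀ :=
    (Γ.arc_contDiff e).contDiffAt.hasStrictDerivAt one_ne_zero
  have h1 := hstrict.hasStrictFDerivAt.isLittleO.def (show 0 < ‖d‖ / 4 by positivity)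
  obtain ⟨η₁, hη₁, h1⟩ := Metric.eventually_nhds_iff.1 h1
  obtain ⟨η₂, hη₂, h2⟩ := Metric.eventually_nhds_iff.1
    ((continuous_deriv_arc e).continuousAt.eventually
      (Metric.ball_mem_nhds (deriv (Γ.arc e) t₀) (show 0 < ‖d‖ / 4 by positivity)))
  obtain ⟨δ, hδ, hb⟩ := exists_ball_inter_carrier e ht₀ hη₁
  have hc : Continuous fun p : ℝ × ℝ => γ p.1 + p.2 * (Complex.I * deriv γ p.1) := by
    have h3 : Continuous fun p : ℝ × ℝ => γ p.1 :=
      (Γ.arc_contDiff e).continuous.comp continuous_fst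
    have h4 : Continuous fun p : ℝ × ℝ => deriv γ p.1 :=
      (continuous_deriv_arc e).comp continuous_fst
    exact h3.add ((Complex.continuous_ofReal.comp continuous_snd).mul (continuous_const.mul h4))
  obtain ⟨η₃, hη₃, h3⟩ := Metric.eventually_nhds_iff.1
    ((hc.continuousAt (x := (t₀, (0 : ℝ)))).eventually (Metric.ball_mem_nhds _ hδ))
  refine ⟨min η₁ (min η₂ η₃), by positivity, fun t ht s hs hs0 => ?_⟩
  simp only [lt_min_iff] at ht hs
  have hm := @h3 (t, s) (by
    rw [Prod.dist_eq, Real.dist_eq, Real.dist_eq]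
    simpa using ⟨ht.2.2, hs.2.2⟩)
  simp only [dist_eq_norm, Complex.ofReal_zero, zero_mul, add_zero] at hm
  obtain ⟨hr, hcar⟩ := hb _ hm
  refine ⟨hr, fun hz => ?_⟩
  obtain ⟨u, hu, hue⟩ := hcar hz
  have e1 := @h1 (u, t) (by
    rw [Prod.dist_eq, Real.dist_eq, Real.dist_eq]
    simpa using ⟨hu, ht.1⟩)
  have e2 := @h2 t (by rw [Real.dist_eq]; exact ht.2.1)
  rw [dist_eq_norm, ← hγ, ← hd] at e2
  simp only [Real.norm_eq_abs, ContinuousLinearMap.toSpanSingleton_apply] at e1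
  rw [show γ u = γ t + s * (Complex.I * deriv γ t) from hue] at e1
  -- If the normal at `t` met the edge again at `u`, strict differentiability would bound the
  -- modulus of `(u - t) - s i` by a quarter of `|u - t| + |s|`. The modulus is at least each of
  -- these two numbers, which forces `s = 0`.
  have e3 : ‖((u - t : ℝ) - s * Complex.I : ℂ) * d‖ ≤ ‖d‖ / 4 * |u - t| + |s| * (‖d‖ / 4) := by
    have : ((u - t : ℝ) - s * Complex.I : ℂ) * d =
      -(γ t + s * (Complex.I * deriv γ t) - γ t - (u - t) • d) +
        s * (Complex.I * (deriv γ t - d)) := by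
      rw [Complex.real_smul]
      push_cast
      ring
    rw [this]
    refine (norm_add_le _ _).trans (add_le_add (by rwa [norm_neg]) ?_)
    rw [norm_mul, norm_mul, Complex.norm_I, one_mul, Complex.norm_real, Real.norm_eq_abs]
    exact mul_le_mul_of_nonneg_left e2.le (abs_nonneg _)
  rw [norm_mul] at e3
  have e4 := Complex.abs_re_le_norm ((u - t : ℝ) - s * Complex.I : ℂ)
  have e5 := Complex.abs_im_le_norm ((u - t : ℝ) - s * Complex.I : ℂ)
  simp only [Complex.sub_re, Complex.sub_im, Complex.ofReal_re, Complex.ofReal_im, Complex.mul_re,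
    Complex.mul_im, Complex.I_re, Complex.I_im, mul_zero, mul_one, zero_sub, sub_zero, add_zero,
    abs_neg] at e4 e5
  have hs' : 0 < |s| := abs_pos.2 hs0
  have e6 : |u - t| / 4 + |s| / 4 ≥ ‖((u - t : ℝ) - s * Complex.I : ℂ)‖ := by
    by_contra hc
    push Not at hc
    have := mul_lt_mul_of_pos_right hc hd0
    linarith
  linarith

/-- Near an inner point of an edge, a cone around the normal direction does not meet the graph. -/
theorem exists_cone_subset_compl (e : Γ.Edge) {t₀ : ℝ} (ht₀ : t₀ ∈ Ioo (0 : ℝ) 1) {c : ℝ}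
    (hc : 0 < c) : ∃ δ > 0, ∀ z, ‖z - Γ.arc e t₀‖ < δ →
      c * ‖z - Γ.arc e t₀‖ < |((z - Γ.arc e t₀) / deriv (Γ.arc e) t₀).im| → z ∈ Γ.compl := by
  set γ := Γ.arc e with hγ
  set d := deriv γ t₀ with hd
  have hd0 : 0 < ‖d‖ := norm_pos_iff.2 (Γ.arc_regular e t₀ ⟨ht₀.1.le, ht₀.2.le⟩)
  -- The first bound keeps `‖γ u - γ t₀‖` above `‖d‖ / 2 * |u - t₀|`; the second keeps the normal
  -- component of `γ u - γ t₀` below `c` times that, so the edge stays out of the cone.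
  set ε := min (‖d‖ / 2) (c * ‖d‖ ^ 2 / 2) with hε
  have hε0 : 0 < ε := by positivity
  have h1 := (hasDerivAt_iff_isLittleO.1 (hasDerivAt_arc e t₀)).def hε0
  obtain ⟨η, hη, h1⟩ := Metric.eventually_nhds_iff.1 h1
  obtain ⟨δ, hδ, hb⟩ := exists_ball_inter_carrier e ht₀ hη
  refine ⟨δ, hδ, fun z hz hcone => ⟨(hb z hz).1, fun hcar => ?_⟩⟩
  obtain ⟨u, hu, rfl⟩ := (hb z hz).2 hcar
  have e1 := h1 (show dist u t₀ < η by rwa [Real.dist_eq])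
  rw [Real.norm_eq_abs, Complex.real_smul, ← hγ, ← hd] at e1
  rw [← hγ] at hcone
  have e2 : |((γ u - γ t₀) / d).im| ≤ ε * |u - t₀| / ‖d‖ := by
    have : (γ u - γ t₀) / d = (γ u - γ t₀ - (u - t₀ : ℝ) * d) / d + (u - t₀ : ℝ) := by
      have := norm_pos_iff.1 hd0
      field_simp
      ring
    rw [this, Complex.add_im, Complex.ofReal_im, add_zero]
    refine (Complex.abs_im_le_norm _).trans ?_
    rw [norm_div]
    gcongr
  have e3 : (‖d‖ - ε) * |u - t₀| ≤ ‖γ u - γ t₀‖ := by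
    have h := norm_sub_norm_le (((u - t₀ : ℝ) : ℂ) * d) (γ u - γ t₀)
    rw [norm_sub_rev (((u - t₀ : ℝ) : ℂ) * d), norm_mul, Complex.norm_real,
      Real.norm_eq_abs] at h
    linarith
  have hε1 : ε ≤ ‖d‖ / 2 := min_le_left _ _
  have hε2 : ε ≤ c * ‖d‖ ^ 2 / 2 := min_le_right _ _
  have e4 : ε * |u - t₀| / ‖d‖ ≤ c * (‖d‖ / 2) * |u - t₀| := by
    rw [div_le_iff₀ hd0]
    calc ε * |u - t₀| ≤ (c * ‖d‖ ^ 2 / 2) * |u - t₀| := by gcongr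
      _ = _ := by ring
  have e5 : c * (‖d‖ / 2) * |u - t₀| ≤ c * ‖γ u - γ t₀‖ := by
    rw [mul_assoc]
    refine mul_le_mul_of_nonneg_left (le_trans ?_ e3) hc.le
    gcongr
    linarith
  linarith

theorem Face.eq_of_mem {F G : Γ.Face} {z : ℂ} (hF : z ∈ F.1) (hG : z ∈ G.1) : F = G :=
  Subtype.ext ((F.eq_component Γ hF).trans (G.eq_component Γ hG).symm)

theorem exists_face_superset {A : Set ℂ} (hA : IsPreconnected A) (hA' : A.Nonempty)
    (h : A ⊆ Γ.compl) : ∃ F : Γ.Face, A ⊆ F.1 := by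
  obtain ⟨p, hp⟩ := hA'
  exact ⟨⟨_, p, h hp, rfl⟩, hA.subset_connectedComponentIn hp h⟩

theorem LeftOf_iff {e : Γ.Edge} {F : Γ.Face} : Γ.LeftOf e F ↔ ∀ t ∈ Ioo (0 : ℝ) 1,
    ∀ᶠ s : ℝ in 𝓝[>] 0, Γ.arc e t + (1 * s : ℝ) * (Complex.I * deriv (Γ.arc e) t) ∈ F.1 := by
  simp [LeftOf]

theorem RightOf_iff {e : Γ.Edge} {F : Γ.Face} : Γ.RightOf e F ↔ ∀ t ∈ Ioo (0 : ℝ) 1,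
    ∀ᶠ s : ℝ in 𝓝[>] 0, Γ.arc e t + (-1 * s : ℝ) * (Complex.I * deriv (Γ.arc e) t) ∈ F.1 := by
  simp [RightOf, sub_eq_add_neg]

/-- Short normals at parameters near `t₀` sweep out a connected set off the graph, hence part of one
face. This face is locally constant in the parameter, so it is the same along the whole edge. The
sign `ε` treats both sides at once. -/
theorem exists_side (e : Γ.Edge) {ε : ℝ} (hε : |ε| = 1) : ∃ F : Γ.Face, ∀ t ∈ Ioo (0 : ℝ) 1,
    ∀ᶠ s : ℝ in 𝓝[>] 0, Γ.arc e t + (ε * s : ℝ) * (Complex.I * deriv (Γ.arc e) t) ∈ F.1 := by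
  have hε0 : ε ≠ 0 := by
    rintro rfl
    simp at hε
  have hloc : ∀ t₀ ∈ Ioo (0 : ℝ) 1, ∃ F : Γ.Face, ∀ᶠ t in 𝓝 t₀,
      ∀ᶠ s : ℝ in 𝓝[>] 0, Γ.arc e t + (ε * s : ℝ) * (Complex.I * deriv (Γ.arc e) t) ∈ F.1 := by
    intro t₀ ht₀
    obtain ⟨η, hη, h⟩ := exists_normals_subset_compl e ht₀
    have hc : Continuous fun p : ℝ × ℝ =>
        Γ.arc e p.1 + (ε * p.2 : ℝ) * (Complex.I * deriv (Γ.arc e) p.1) := by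
      have h3 : Continuous fun p : ℝ × ℝ => Γ.arc e p.1 :=
        (Γ.arc_contDiff e).continuous.comp continuous_fst
      have h4 : Continuous fun p : ℝ × ℝ => deriv (Γ.arc e) p.1 :=
        (continuous_deriv_arc e).comp continuous_fst
      fun_prop
    obtain ⟨F, hF⟩ := exists_face_superset (Γ := Γ)
      (A := (fun p : ℝ × ℝ => Γ.arc e p.1 + (ε * p.2 : ℝ) * (Complex.I * deriv (Γ.arc e) p.1)) ''
        (Ioo (t₀ - η) (t₀ + η) ×ˢ Ioo 0 η))
      ((isPreconnected_Ioo.prod isPreconnected_Ioo).image _ hc.continuousOn)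
      (((nonempty_Ioo.2 (by linarith)).prod (nonempty_Ioo.2 hη)).image _) (by
        rintro _ ⟨⟨t, s⟩, ⟨ht, hs⟩, rfl⟩
        refine h t (abs_lt.2 ⟨by linarith [ht.1], by linarith [ht.2]⟩) _ ?_ ?_
        · rw [abs_mul, hε, one_mul, abs_of_pos hs.1]
          exact hs.2
        · exact mul_ne_zero hε0 hs.1.ne')
    refine ⟨F, ?_⟩
    filter_upwards [Ioo_mem_nhds (show t₀ - η < t₀ by linarith) (show t₀ < t₀ + η by linarith)]
      with t ht
    filter_upwards [Ioo_mem_nhdsGT hη] with s hs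
    exact hF ⟨(t, s), ⟨ht, hs⟩, rfl⟩
  have hmid : (1 / 2 : ℝ) ∈ Ioo (0 : ℝ) 1 := by norm_num
  have : Nonempty Γ.Face := ⟨(hloc _ hmid).choose⟩
  choose! F hF using hloc
  refine ⟨F (1 / 2), fun t ht => ?_⟩
  have hsub : Ioo (0 : ℝ) 1 ⊆ {t | F t = F (1 / 2)} := by
    have hlc : ∀ t ∈ Ioo (0 : ℝ) 1, ∀ᶠ u in 𝓝[Ioo (0 : ℝ) 1] t, F t = F u := by
      intro t ht
      filter_upwards [mem_nhdsWithin_of_mem_nhds (hF t ht), self_mem_nhdsWithin] with u hu hu'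
      obtain ⟨s, hs1, hs2⟩ := (hu.and (hF u hu').self_of_nhds).exists
      exact Face.eq_of_mem hs1 hs2
    intro t ht
    exact (isPreconnected_Ioo.induction₂' (fun x y => F x = F y)
      (fun x hx => by
        filter_upwards [hlc x hx] with y hy
        exact ⟨hy, hy.symm⟩) (fun x y z _ _ _ h h' => h.trans h') hmid ht).symm
  have : F t = F (1 / 2) := hsub ht
  rw [← this]
  exact (hF t ht).self_of_nhds

theorem exists_leftOf (e : Γ.Edge) : ∃ F, Γ.LeftOf e F := by
  simpa only [LeftOf_iff] using exists_side e abs_one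

theorem exists_rightOf (e : Γ.Edge) : ∃ F, Γ.RightOf e F := by
  simpa only [RightOf_iff] using exists_side e (ε := -1) (by simp)

theorem LeftOf.unique {e : Γ.Edge} {F G : Γ.Face} (hF : Γ.LeftOf e F) (hG : Γ.LeftOf e G) :
    F = G := by
  obtain ⟨s, hs, hs'⟩ := ((hF (1 / 2) (by norm_num)).and (hG (1 / 2) (by norm_num))).exists
  exact Face.eq_of_mem hs hs'

theorem RightOf.unique {e : Γ.Edge} {F G : Γ.Face} (hF : Γ.RightOf e F) (hG : Γ.RightOf e G) :
    F = G := by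
  obtain ⟨s, hs, hs'⟩ := ((hF (1 / 2) (by norm_num)).and (hG (1 / 2) (by norm_num))).exists
  exact Face.eq_of_mem hs hs'

theorem convex_cone (p d : ℂ) (c δ ε : ℝ) (hc : 0 ≤ c) :
    Convex ℝ {z : ℂ | ‖z - p‖ < δ ∧ c * ‖z - p‖ < ε * ((z - p) / d).im} := by
  intro x hx y hy a b ha hb hab
  have hz : a • x + b • y - p = a * (x - p) + b * (y - p) := by
    simp only [Complex.real_smul]
    linear_combination p * (by exact_mod_cast hab : (a : ℂ) + b = 1)
  have hn : ‖a • x + b • y - p‖ ≤ a * ‖x - p‖ + b * ‖y - p‖ := by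
    rw [hz]
    refine (norm_add_le _ _).trans_eq ?_
    rw [norm_mul, norm_mul, Complex.norm_real, Complex.norm_real, Real.norm_of_nonneg ha,
      Real.norm_of_nonneg hb]
  have hi : ((a • x + b • y - p) / d).im = a * ((x - p) / d).im + b * ((y - p) / d).im := by
    rw [hz, add_div, mul_div_assoc, mul_div_assoc, Complex.add_im, Complex.im_ofReal_mul,
      Complex.im_ofReal_mul]
  have key : ∀ u v w z : ℝ, u < v → w < z → a * u + b * w < a * v + b * z := by
    intro u v w z h1 h2
    rcases ha.eq_or_lt with rfl | ha'
    · have : b = 1 := by linarith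
      subst this
      linarith
    · have h3 := mul_lt_mul_of_pos_left h1 ha'
      have h4 := mul_le_mul_of_nonneg_left h2.le hb
      linarith
  constructor
  · refine hn.trans_lt ((key _ _ _ _ hx.1 hy.1).trans_eq ?_)
    rw [← add_mul, hab, one_mul]
  · rw [hi]
    have h1 := mul_le_mul_of_nonneg_left hn hc
    have h2 := key _ _ _ _ hx.2 hy.2
    calc _ ≤ _ := h1
      _ = a * (c * ‖x - p‖) + b * (c * ‖y - p‖) := by ring
      _ < _ := h2
      _ = _ := by ring

/-- A thin cone around the normal is convex, avoids the graph and contains a point of the normal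
already known to be in `F`, so it lies in `F`. This replaces the normal by an arbitrary transversal
direction. -/
theorem side_cone (e : Γ.Edge) {ε : ℝ} (hε : |ε| = 1) {F : Γ.Face} {t : ℝ}
    (ht : t ∈ Ioo (0 : ℝ) 1) (hF : ∀ᶠ s : ℝ in 𝓝[>] 0,
      Γ.arc e t + (ε * s : ℝ) * (Complex.I * deriv (Γ.arc e) t) ∈ F.1) {c : ℝ} (hc : 0 < c) :
    ∀ᶠ z in 𝓝 (Γ.arc e t), c * ‖z - Γ.arc e t‖ <
      ε * ((z - Γ.arc e t) / deriv (Γ.arc e) t).im → z ∈ F.1 := by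
  set p := Γ.arc e t with hp
  set d := deriv (Γ.arc e) t with hd
  have hd0 : d ≠ 0 := Γ.arc_regular e t ⟨ht.1.le, ht.2.le⟩
  -- On the normal, `‖z - p‖ = s ‖d‖` while the imaginary part is `± s`; a slope below `1 / ‖d‖`
  -- makes the cone contain the normal.
  set c' := min c (1 / (2 * ‖d‖)) with hc'
  have hdn : 0 < ‖d‖ := norm_pos_iff.2 hd0
  have hc'0 : 0 < c' := by positivity
  obtain ⟨δ, hδ, h⟩ := exists_cone_subset_compl e ht hc'0
  have hεε : ε * ε = 1 := by rw [← abs_mul_abs_self, hε, one_mul]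
  obtain ⟨s, hs, hs'⟩ := (hF.and (Ioo_mem_nhdsGT (show 0 < δ / ‖d‖ by positivity))).exists
  have hsub := F.subset_of_isPreconnected Γ (convex_cone p d c' δ ε hc'0.le).isPreconnected
    (fun z hz => h z hz.1 (hz.2.trans_le (by
      refine (le_abs_self _).trans_eq ?_
      rw [abs_mul, hε, one_mul]))) hs ?_
  · filter_upwards [Metric.ball_mem_nhds p hδ] with z hz hz'
    refine hsub ⟨mem_ball_iff_norm.1 hz, lt_of_le_of_lt ?_ hz'⟩
    gcongr
    exact min_le_left _ _
  · have hn : ‖((ε * s : ℝ) : ℂ) * (Complex.I * d)‖ = s * ‖d‖ := by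
      rw [norm_mul, norm_mul, Complex.norm_I, one_mul, Complex.norm_real, Real.norm_eq_abs,
        abs_mul, hε, one_mul, abs_of_pos hs'.1]
    have hq : ((ε * s : ℝ) : ℂ) * (Complex.I * d) / d = ((ε * s : ℝ) : ℂ) * Complex.I := by
      field_simp
    simp only [mem_ofPred_eq, add_sub_cancel_left]
    rw [hn, hq]
    refine ⟨(lt_div_iff₀ hdn).1 hs'.2, ?_⟩
    rw [Complex.im_ofReal_mul, Complex.I_im, mul_one, ← mul_assoc ε ε s, hεε, one_mul]
    have : c' * ‖d‖ ≤ 1 / 2 := by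
      calc c' * ‖d‖ ≤ 1 / (2 * ‖d‖) * ‖d‖ := by gcongr; exact min_le_right _ _
        _ = 1 / 2 := by field_simp
    nlinarith [hs'.1]

theorem side_eventually (e : Γ.Edge) {ε : ℝ} (hε : |ε| = 1) {F : Γ.Face} {t : ℝ}
    (ht : t ∈ Ioo (0 : ℝ) 1) (hF : ∀ᶠ s : ℝ in 𝓝[>] 0,
      Γ.arc e t + (ε * s : ℝ) * (Complex.I * deriv (Γ.arc e) t) ∈ F.1) {z : ℝ → ℂ} {z' : ℂ} {x : ℝ}
    (hz : HasDerivAt z z' x) (hx : z x = Γ.arc e t) (hpos : 0 < ε * (z' / deriv (Γ.arc e) t).im) :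
    ∀ᶠ u in 𝓝[>] x, z u ∈ F.1 := by
  set d := deriv (Γ.arc e) t with hd
  set m := ε * (z' / d).im with hm
  -- The difference quotients of `z` eventually have norm below `‖z'‖ + 1` and signed normal
  -- component above `m / 2`, so the curve enters the cone of this slope.
  have hc : 0 < m / (2 * (‖z'‖ + 1)) := by positivity
  have h1 := (hz.continuousAt.tendsto.mono_left nhdsWithin_le_nhds).eventually
    (hx ▸ side_cone e hε ht hF hc : ∀ᶠ w in 𝓝 (z x), _) (l₁ := 𝓝[>] x)
  have h2 := (hasDerivAt_iff_tendsto_slope.1 hz).mono_left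
    (nhdsWithin_mono x (fun u (hu : x < u) => hu.ne'))
  have h3 : Tendsto (fun u => ε * (slope z x u / d).im) (𝓝[>] x) (𝓝 m) :=
    ((Complex.continuous_im.tendsto _).comp (h2.div_const d)).const_mul ε
  have h4 : ∀ᶠ u in 𝓝[>] x, m / 2 < ε * (slope z x u / d).im :=
    h3.eventually (lt_mem_nhds (by linarith))
  have h5 : ∀ᶠ u in 𝓝[>] x, ‖slope z x u‖ < ‖z'‖ + 1 :=
    h2.norm.eventually (gt_mem_nhds (by linarith))
  filter_upwards [h1, h4, h5, self_mem_nhdsWithin] with u h1 h4 h5 hu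
  apply h1
  have hu' : 0 < u - x := sub_pos.2 hu
  have hsl : z u - z x = (u - x : ℝ) * slope z x u := by
    rw [slope_def_module, ← Complex.real_smul, smul_smul, mul_inv_cancel₀ hu'.ne', one_smul]
  rw [hsl, norm_mul, Complex.norm_real, Real.norm_of_nonneg hu'.le, mul_div_assoc _ _ (deriv _ _),
    Complex.im_ofReal_mul]
  have h6 : m / (2 * (‖z'‖ + 1)) * ‖slope z x u‖ ≤ m / 2 := by
    calc _ ≤ m / (2 * (‖z'‖ + 1)) * (‖z'‖ + 1) := by gcongr
      _ = m / 2 := by field_simp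
  have h7 := mul_lt_mul_of_pos_left (h6.trans_lt h4) hu'
  nlinarith

section
variable {e : Γ.Edge} {F : Γ.Face} {t : ℝ} {z : ℝ → ℂ} {z' : ℂ} {x : ℝ}

theorem LeftOf.eventually_gt (hF : Γ.LeftOf e F) (ht : t ∈ Ioo (0 : ℝ) 1)
    (hz : HasDerivAt z z' x) (hx : z x = Γ.arc e t) (hpos : 0 < (z' / deriv (Γ.arc e) t).im) :
    ∀ᶠ u in 𝓝[>] x, z u ∈ F.1 :=
  side_eventually e abs_one ht (LeftOf_iff.1 hF t ht) hz hx (by linarith)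

theorem RightOf.eventually_gt (hF : Γ.RightOf e F) (ht : t ∈ Ioo (0 : ℝ) 1)
    (hz : HasDerivAt z z' x) (hx : z x = Γ.arc e t) (hneg : (z' / deriv (Γ.arc e) t).im < 0) :
    ∀ᶠ u in 𝓝[>] x, z u ∈ F.1 :=
  side_eventually e (by simp) ht (RightOf_iff.1 hF t ht) hz hx (by linarith)

theorem eventually_nhdsLT_of_neg {P : ℝ → Prop} (h : ∀ᶠ u in 𝓝[>] (-x), P (-u)) :
    ∀ᶠ u in 𝓝[<] x, P u := by
  have : Tendsto (fun u : ℝ => -u) (𝓝[<] x) (𝓝[>] (-x)) := tendsto_neg_nhdsLT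
  simpa using this.eventually h

theorem hasDerivAt_comp_neg (hz : HasDerivAt z z' x) :
    HasDerivAt (fun u => z (-u)) (-z') (-x) := by
  have h : HasDerivAt z z' (-(-x)) := by rwa [neg_neg]
  have := h.scomp (-x) (hasDerivAt_neg (-x))
  rwa [neg_one_smul] at this

theorem LeftOf.eventually_lt (hF : Γ.LeftOf e F) (ht : t ∈ Ioo (0 : ℝ) 1)
    (hz : HasDerivAt z z' x) (hx : z x = Γ.arc e t) (hneg : (z' / deriv (Γ.arc e) t).im < 0) :
    ∀ᶠ u in 𝓝[<] x, z u ∈ F.1 :=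
  eventually_nhdsLT_of_neg (hF.eventually_gt ht (hasDerivAt_comp_neg hz) (by simpa using hx)
    (by rw [neg_div, Complex.neg_im]; linarith))

theorem RightOf.eventually_lt (hF : Γ.RightOf e F) (ht : t ∈ Ioo (0 : ℝ) 1)
    (hz : HasDerivAt z z' x) (hx : z x = Γ.arc e t) (hpos : 0 < (z' / deriv (Γ.arc e) t).im) :
    ∀ᶠ u in 𝓝[<] x, z u ∈ F.1 :=
  eventually_nhdsLT_of_neg (hF.eventually_gt ht (hasDerivAt_comp_neg hz) (by simpa using hx)
    (by rw [neg_div, Complex.neg_im]; linarith))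

end

/-! ### Edges on the boundary of a face -/

/-- Inner points of the edge are limits of points of `F` on the normals and lie off `F`; the
endpoints follow because the frontier is closed. -/
theorem side_subset_frontier {e : Γ.Edge} {F : Γ.Face} (h : Γ.LeftOf e F ∨ Γ.RightOf e F) :
    Γ.edgeSet e ⊆ frontier F.1 := by
  have hin : ∀ t ∈ Ioo (0 : ℝ) 1, Γ.arc e t ∈ frontier F.1 := by
    intro t ht
    refine ⟨?_, ?_⟩
    · rcases h with h | h
      · refine mem_closure_of_tendsto (f := fun s : ℝ =>
          Γ.arc e t + s * (Complex.I * deriv (Γ.arc e) t)) (b := 𝓝[>] 0) ?_ (h t ht)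
        refine tendsto_nhdsWithin_of_tendsto_nhds (Continuous.tendsto' ?_ _ _ (by simp))
        fun_prop
      · refine mem_closure_of_tendsto (f := fun s : ℝ =>
          Γ.arc e t - s * (Complex.I * deriv (Γ.arc e) t)) (b := 𝓝[>] 0) ?_ (h t ht)
        refine tendsto_nhdsWithin_of_tendsto_nhds (Continuous.tendsto' ?_ _ _ (by simp))
        fun_prop
    · rw [(F.isOpen Γ).interior_eq]
      intro hm
      exact (F.subset_compl Γ hm).2 (Or.inr (mem_iUnion.2 ⟨e, t, ⟨ht.1.le, ht.2.le⟩, rfl⟩))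
  calc Γ.edgeSet e = Γ.arc e '' closure (Ioo 0 1) := by rw [closure_Ioo zero_ne_one, edgeSet]
    _ ⊆ closure (Γ.arc e '' Ioo 0 1) :=
      image_closure_subset_closure_image (Γ.arc_contDiff e).continuous
    _ ⊆ frontier F.1 := closure_minimal (image_subset_iff.2 hin) isClosed_frontier

theorem endpoint_mem_edgeSet (e : Γ.Edge) (b : Bool) : Γ.endpoint e b ∈ Γ.edgeSet e :=
  ⟨cond b 1 0, by cases b <;> simp, rfl⟩

theorem edge_eq_of_subset {e : Γ.Edge} {ι : Type*} {f : ι → Γ.Edge}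
    (h : Γ.edgeSet e ⊆ ⋃ i, Γ.edgeSet (f i)) : ∃ i, f i = e := by
  have hm : (1 / 2 : ℝ) ∈ Ioo (0 : ℝ) 1 := by norm_num
  obtain ⟨i, t, ht, hte⟩ := mem_iUnion.1 (h ⟨1 / 2, ⟨hm.1.le, hm.2.le⟩, rfl⟩)
  exact ⟨i, (eq_of_arc_eq hm ht hte).1⟩

theorem edgeSet_injective : Function.Injective Γ.edgeSet := fun e f h => by
  obtain ⟨-, h⟩ := edge_eq_of_subset (e := e) (f := fun _ : Unit => f)
    (h.subset.trans (subset_iUnion (fun _ : Unit => Γ.edgeSet f) ()))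
  exact h.symm

theorem endpoint_mem_corners {e : Γ.Edge} {F : Γ.Face} (h : Γ.LeftOf e F ∨ Γ.RightOf e F)
    (b : Bool) : Γ.endpoint e b ∈ Γ.corners F :=
  ⟨⟨e, b, rfl⟩, side_subset_frontier h (endpoint_mem_edgeSet e b)⟩

theorem Arrow.sides {e : Γ.Edge} {F G : Γ.Face} (h : Γ.Arrow e F G) :
    (Γ.LeftOf e F ∨ Γ.RightOf e F) ∧ (Γ.LeftOf e G ∨ Γ.RightOf e G) := by
  rcases h with ⟨-, h1, h2⟩ | ⟨-, h1, h2⟩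
  · exact ⟨Or.inl h1, Or.inr h2⟩
  · exact ⟨Or.inr h1, Or.inl h2⟩

/-! ### The mirror image of an edge -/

section Reparametrisation

variable {e f : Γ.Edge}

/-- This controls a mere choice of parameters `τ` by compactness: it serves both for the continuity
of `τ` and for its behaviour at the ends, where `τ` says nothing directly. -/
theorem arc_eq_of_mapClusterPt {τ : ℝ → ℝ}
    (hτ : ∀ t ∈ Ioo (0 : ℝ) 1, Γ.arc f (τ t) = conj (Γ.arc e t)) {T u : ℝ}
    (h : MapClusterPt u (𝓝[Ioo 0 1] T) τ) : Γ.arc f u = conj (Γ.arc e T) := by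
  have h1 : MapClusterPt (Γ.arc f u) (𝓝[Ioo 0 1] T) (Γ.arc f ∘ τ) :=
    h.continuousAt_comp (Γ.arc_contDiff f).continuous.continuousAt
  have h2 : Tendsto (Γ.arc f ∘ τ) (𝓝[Ioo 0 1] T) (𝓝 (conj (Γ.arc e T))) := by
    have hc : Continuous fun t => conj (Γ.arc e t) :=
      Complex.continuous_conj.comp (Γ.arc_contDiff e).continuous
    refine (hc.continuousAt.tendsto.mono_left nhdsWithin_le_nhds).congr' ?_
    filter_upwards [self_mem_nhdsWithin] with t ht using (hτ t ht).symm
  exact eq_of_nhds_neBot (h1.neBot.mono (inf_le_inf_left _ h2))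

theorem conj_endpoint_notMem_arc (hΓ : ∀ z, z ∈ Γ.internal → conj z ∈ Γ.internal) {b : Bool}
    {u : ℝ} (hu : u ∈ Ioo (0 : ℝ) 1) (h : Γ.arc f u = conj (Γ.endpoint e b)) : False := by
  have hm := Γ.arc_mem f u hu
  rw [h] at hm
  rcases Γ.endpoint_cases e b with h1 | h1
  · exact hm.2 (hΓ _ h1)
  · exact h1 (conj_mem_openRect.1 hm.1)

/-- Continuity needs no inverse function theorem: the values lie in the compact interval `[0, 1]`,
and each cluster point at `t` has to be `τ t` since the arc has no self-intersections. -/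
theorem exists_reparametrisation (hΓ : ∀ z, z ∈ Γ.internal → conj z ∈ Γ.internal)
    (h : Γ.edgeSet f = conj '' Γ.edgeSet e) : ∃ τ : ℝ → ℝ, MapsTo τ (Ioo 0 1) (Ioo 0 1) ∧
      (∀ t ∈ Ioo (0 : ℝ) 1, Γ.arc f (τ t) = conj (Γ.arc e t)) ∧ ContinuousOn τ (Ioo 0 1) ∧
      InjOn τ (Ioo 0 1) := by
  have hex : ∀ t ∈ Ioo (0 : ℝ) 1, ∃ u ∈ Ioo (0 : ℝ) 1, Γ.arc f u = conj (Γ.arc e t) := by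
    intro t ht
    have hm : conj (Γ.arc e t) ∈ Γ.edgeSet f :=
      h ▸ mem_image_of_mem _ ⟨t, ⟨ht.1.le, ht.2.le⟩, rfl⟩
    obtain ⟨u, hu, hue⟩ := hm
    refine ⟨u, mem_Ioo_of_arc_mem f hu ?_ ?_, hue⟩
    · rw [hue]
      exact conj_mem_openRect.2 (Γ.arc_mem e t ht).1
    · rw [hue]
      intro hv
      have := hΓ _ hv
      rw [Complex.conj_conj] at this
      exact (Γ.arc_mem e t ht).2 this
  choose! τ hτ1 hτ2 using hex
  refine ⟨τ, hτ1, hτ2, fun t ht => ?_, fun s hs t ht hst => ?_⟩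
  · refine isCompact_Icc.tendsto_nhds_of_unique_mapClusterPt (s := Icc (0 : ℝ) 1) ?_ ?_
    · filter_upwards [self_mem_nhdsWithin] with s hs using ⟨(hτ1 s hs).1.le, (hτ1 s hs).2.le⟩
    · intro u hu hcl
      have := arc_eq_of_mapClusterPt hτ2 hcl
      rw [← hτ2 t ht] at this
      exact (eq_of_arc_eq (hτ1 t ht) hu this).2
  · have : conj (Γ.arc e s) = conj (Γ.arc e t) := by rw [← hτ2 s hs, ← hτ2 t ht, hst]
    exact (eq_of_arc_eq ht ⟨hs.1.le, hs.2.le⟩ ((starRingEnd ℂ).injective this)).2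

/-- A cluster point of `τ` at an end of `e` cannot be an inner parameter of `f`, since reflected
endpoints are not inner points of edges. So it is 0 or 1, and `[a, b]` contains at most one of them.
-/
theorem endpoint_eq_of_eventually (hΓ : ∀ z, z ∈ Γ.internal → conj z ∈ Γ.internal) {τ : ℝ → ℝ}
    (hτ : ∀ t ∈ Ioo (0 : ℝ) 1, Γ.arc f (τ t) = conj (Γ.arc e t)) {a b : ℝ} (ha : 0 ≤ a)
    (hb : b ≤ 1) (hab : 0 < a ∨ b < 1) (B : Bool)
    (hev : ∀ᶠ t in 𝓝[Ioo 0 1] (cond B 1 0), τ t ∈ Icc a b) :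
    Γ.arc f (if 0 < a then 1 else 0) = conj (Γ.endpoint e B) := by
  have hne : (𝓝[Ioo (0 : ℝ) 1] (cond B 1 0)).NeBot := by
    rw [← mem_closure_iff_nhdsWithin_neBot, closure_Ioo zero_ne_one]
    cases B <;> simp
  obtain ⟨u, hu, hcl⟩ := isCompact_Icc.exists_mapClusterPt_of_frequently hev.frequently
  have h1 : Γ.arc f u = conj (Γ.endpoint e B) := arc_eq_of_mapClusterPt hτ hcl
  have h2 : ¬ (0 < u ∧ u < 1) := fun hu => conj_endpoint_notMem_arc hΓ hu h1
  split_ifs with h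
  · have : u = 1 := by
      by_contra hc
      exact h2 ⟨h.trans_le hu.1, lt_of_le_of_ne (hu.2.trans hb) hc⟩
    rwa [← this]
  · have : u = 0 := by
      by_contra hc
      exact h2 ⟨lt_of_le_of_ne (ha.trans hu.1) (Ne.symm hc),
        hu.2.trans_lt (hab.resolve_left h)⟩
    rwa [← this]

theorem _root_.HasDerivAt.conj_comp {z : ℝ → ℂ} {z' : ℂ} {x : ℝ} (hz : HasDerivAt z z' x) :
    HasDerivAt (fun s => conj (z s)) (conj z') x :=
  Complex.conjCLE.toContinuousLinearMap.hasFDerivAt.comp_hasDerivAt x hz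

/-- The quotient of corresponding secants of the two arcs is real and has the sign of the slope of
`τ`. The sign survives in the limit, which is nonzero by regularity, so `τ` need not be
differentiated. -/
theorem conj_deriv_div {τ : ℝ → ℝ} (hm : MapsTo τ (Ioo 0 1) (Ioo 0 1))
    (hτ : ∀ t ∈ Ioo (0 : ℝ) 1, Γ.arc f (τ t) = conj (Γ.arc e t))
    (hc : ContinuousOn τ (Ioo 0 1)) (hi : InjOn τ (Ioo 0 1)) {ε : ℝ} (hε : ε ≠ 0)
    (hmono : ∀ s ∈ Ioo (0 : ℝ) 1, ∀ t ∈ Ioo (0 : ℝ) 1, s ≠ t → 0 ≤ ε * ((τ s - τ t) / (s - t)))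
    {t : ℝ} (ht : t ∈ Ioo (0 : ℝ) 1) :
    0 < ε * (conj (deriv (Γ.arc e) t) / deriv (Γ.arc f) (τ t)).re := by
  have hI : Ioo (0 : ℝ) 1 ∈ 𝓝 t := isOpen_Ioo.mem_nhds ht
  have h1 : Tendsto (slope (fun t => conj (Γ.arc e t)) t) (𝓝[≠] t)
      (𝓝 (conj (deriv (Γ.arc e) t))) :=
    hasDerivAt_iff_tendsto_slope.1 (hasDerivAt_arc e t).conj_comp
  have h2 : Tendsto (slope (Γ.arc f) (τ t)) (𝓝[≠] (τ t)) (𝓝 (deriv (Γ.arc f) (τ t))) :=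
    hasDerivAt_iff_tendsto_slope.1 (hasDerivAt_arc f (τ t))
  have hev : ∀ᶠ s in 𝓝[≠] t, s ∈ Ioo (0 : ℝ) 1 := mem_nhdsWithin_of_mem_nhds hI
  have h3 : Tendsto τ (𝓝[≠] t) (𝓝[≠] (τ t)) := by
    refine tendsto_nhdsWithin_iff.2
      ⟨(hc.continuousAt hI).tendsto.mono_left nhdsWithin_le_nhds, ?_⟩
    filter_upwards [hev, self_mem_nhdsWithin] with s hs hst h
    exact hst (hi hs ht h)
  have hg : deriv (Γ.arc f) (τ t) ≠ 0 := Γ.arc_regular f _ ⟨(hm ht).1.le, (hm ht).2.le⟩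
  have hd : conj (deriv (Γ.arc e) t) ≠ 0 :=
    (map_ne_zero _).2 (Γ.arc_regular e t ⟨ht.1.le, ht.2.le⟩)
  have h4 := h1.div (h2.comp h3) hg
  have hcl : IsClosed {w : ℂ | 0 ≤ ε * w.re ∧ w.im = 0} :=
    (isClosed_le continuous_const (continuous_const.mul Complex.continuous_re)).inter
      (isClosed_eq Complex.continuous_im continuous_const)
  have h5 := hcl.mem_of_tendsto h4 (by
    filter_upwards [hev, self_mem_nhdsWithin] with s hs hst
    have hst' : s - t ≠ 0 := sub_ne_zero.2 hst
    have hτst : τ s - τ t ≠ 0 := sub_ne_zero.2 fun h => hst (hi hs ht h)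
    have hne : conj (Γ.arc e s) - conj (Γ.arc e t) ≠ 0 := by
      rw [sub_ne_zero, ← hτ s hs, ← hτ t ht]
      intro h
      exact hτst (sub_eq_zero.2 (eq_of_arc_eq (hm ht) ⟨(hm hs).1.le, (hm hs).2.le⟩ h).2)
    have : slope (fun t => conj (Γ.arc e t)) t s / (slope (Γ.arc f) (τ t) ∘ τ) s =
        (((τ s - τ t) / (s - t) : ℝ) : ℂ) := by
      simp only [Function.comp_apply, slope_def_module, hτ s hs, hτ t ht, Complex.real_smul]
      push_cast
      have h6 : ((s : ℂ) - t) ≠ 0 := by exact_mod_cast hst'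
      have h7 : ((τ s : ℂ) - τ t) ≠ 0 := by exact_mod_cast hτst
      field_simp
    rw [Pi.div_apply, this]
    exact ⟨by rw [Complex.ofReal_re]; exact hmono s hs t ht hst, Complex.ofReal_im _⟩)
  refine lt_of_le_of_ne h5.1 fun h0 => ?_
  have : conj (deriv (Γ.arc e) t) / deriv (Γ.arc f) (τ t) = 0 :=
    Complex.ext ((mul_eq_zero.1 h0.symm).resolve_left hε) h5.2
  exact div_ne_zero hd hg this

end Reparametrisation

/-! ### Reflection of vertices, faces, edges and arrows -/

namespace IsMoveSymmetric

-- The moves recolour exactly the vertices of the squares, and the reflected graph has opposite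
-- colours everywhere. The two changes cancel at the squares and nowhere else.
open Classical in
theorem conj_mem_cases (hΓ : Γ.IsMoveSymmetric) {z : ℂ} :
    (z ∈ Γ.black → conj z ∈ if z ∈ Γ.squareVertices then Γ.black else Γ.white) ∧
    (z ∈ Γ.white → conj z ∈ if z ∈ Γ.squareVertices then Γ.white else Γ.black) := by
  have h1 : ∀ z ∈ Γ.movedBlack, conj z ∈ Γ.white := fun z h => by
    have := hΓ.movedBlack_symm ▸ mem_image_of_mem conj h
    exact this
  have h2 : ∀ z ∈ Γ.movedWhite, conj z ∈ Γ.black := fun z h => by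
    have := hΓ.movedWhite_symm ▸ mem_image_of_mem conj h
    exact this
  constructor <;> intro h <;> split_ifs with hs
  · exact h2 z (Or.inr ⟨h, hs⟩)
  · exact h1 z (Or.inl ⟨h, hs⟩)
  · exact h1 z (Or.inr ⟨h, hs⟩)
  · exact h2 z (Or.inl ⟨h, hs⟩)

theorem conj_mem_internal (hΓ : Γ.IsMoveSymmetric) (z : ℂ) (hz : z ∈ Γ.internal) :
    conj z ∈ Γ.internal := by
  have h := hΓ.conj_mem_cases (z := z)
  simp only [internal, Finset.mem_union] at hz ⊢
  split_ifs at h <;> tauto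

/-- Vertices of the squares on the midline are symmetric to vertices of the same colour. -/
theorem conj_mem_black_iff (hΓ : Γ.IsMoveSymmetric) {z : ℂ} (hz : z ∈ Γ.squareVertices) :
    conj z ∈ Γ.black ↔ z ∈ Γ.black := by
  refine ⟨fun h => ?_, fun h => by simpa [hz] using hΓ.conj_mem_cases.1 h⟩
  rw [← Finset.mem_coe, ← hΓ.movedWhite_symm] at h
  obtain ⟨w, hw, hwz⟩ := h
  rw [(starRingEnd ℂ).injective hwz] at hw
  rcases hw with hw | hw
  · exact absurd hz hw.2
  · exact hw.1

theorem conj_mem_white_iff (hΓ : Γ.IsMoveSymmetric) {z : ℂ} (hz : z ∈ Γ.squareVertices) :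
    conj z ∈ Γ.white ↔ z ∈ Γ.white := by
  refine ⟨fun h => ?_, fun h => by simpa [hz] using hΓ.conj_mem_cases.2 h⟩
  rw [← Finset.mem_coe, ← hΓ.movedBlack_symm] at h
  obtain ⟨w, hw, hwz⟩ := h
  rw [(starRingEnd ℂ).injective hwz] at hw
  rcases hw with hw | hw
  · exact absurd hz hw.2
  · exact hw.1

theorem blackToWhite_conj_iff (hΓ : Γ.IsMoveSymmetric) {u v : ℂ} (hu : u ∈ Γ.squareVertices)
    (hv : v ∈ Γ.squareVertices) : Γ.BlackToWhite (conj u) (conj v) ↔ Γ.BlackToWhite u v := by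
  simp only [BlackToWhite, hΓ.conj_mem_black_iff hu, hΓ.conj_mem_black_iff hv,
    hΓ.conj_mem_white_iff hu, hΓ.conj_mem_white_iff hv]

theorem conj_mem_mirror (hΓ : Γ.IsMoveSymmetric) {F : Γ.Face} {z : ℂ} (hz : z ∈ F.1) :
    conj z ∈ (hΓ.mirror F).1 := mem_image_of_mem _ hz

@[simp]
theorem mirror_mirror (hΓ : Γ.IsMoveSymmetric) (F : Γ.Face) : hΓ.mirror (hΓ.mirror F) = F := by
  refine Subtype.ext ?_
  change conj '' (conj '' F.1) = F.1
  rw [image_image]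
  simp

theorem mirror_eq_of_im_eq_zero (hΓ : Γ.IsMoveSymmetric) {F : Γ.Face} {p : ℂ} (hp : p ∈ F.1)
    (h : p.im = 0) : hΓ.mirror F = F := by
  refine Face.eq_of_mem (z := p) ?_ hp
  have := hΓ.conj_mem_mirror hp
  rwa [Complex.conj_eq_iff_im.2 h] at this

theorem mirror_of_isMidSquare (hΓ : Γ.IsMoveSymmetric) {k : Γ.Face} (hk : Γ.IsMidSquare k) :
    hΓ.mirror k = k := by
  obtain ⟨⟨p, hp, h⟩, -⟩ := hk
  exact hΓ.mirror_eq_of_im_eq_zero hp h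

theorem isMidSquare_mirror (hΓ : Γ.IsMoveSymmetric) {F : Γ.Face} :
    Γ.IsMidSquare (hΓ.mirror F) ↔ Γ.IsMidSquare F := by
  constructor
  · intro h
    have := hΓ.mirror_of_isMidSquare h
    rw [mirror_mirror] at this
    rwa [this]
  · intro h
    rwa [hΓ.mirror_of_isMidSquare h]

theorem not_isMidSquare_of_isUpper {F : Γ.Face} (hF : IsUpper F) : ¬ Γ.IsMidSquare F := by
  rintro ⟨⟨p, hp, h⟩, -⟩
  exact (hF p hp).ne' h

/-- The edge symmetric to the edge `e` with respect to the midline. -/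
def mirrorEdge (hΓ : Γ.IsMoveSymmetric) (e : Γ.Edge) : Γ.Edge := (hΓ.edge_symm e).choose

theorem edgeSet_mirrorEdge (hΓ : Γ.IsMoveSymmetric) (e : Γ.Edge) :
    Γ.edgeSet (hΓ.mirrorEdge e) = conj '' Γ.edgeSet e := (hΓ.edge_symm e).choose_spec

theorem mirrorEdge_injective (hΓ : Γ.IsMoveSymmetric) : Function.Injective hΓ.mirrorEdge := by
  intro e f h
  have h1 := hΓ.edgeSet_mirrorEdge e
  rw [h, hΓ.edgeSet_mirrorEdge f] at h1
  exact (edgeSet_injective ((starRingEnd ℂ).injective.image_injective h1)).symm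

/-- The reflected normal of `e` is a curve starting on `f` and crossing it transversely. The sign of
the real part is the relative direction of the two edges and decides on which side of `f` it starts.
-/
theorem mirror_side (hΓ : Γ.IsMoveSymmetric) {e f : Γ.Edge} {t u : ℝ} (ht : t ∈ Ioo (0 : ℝ) 1)
    (hu : u ∈ Ioo (0 : ℝ) 1) (h : Γ.arc f u = conj (Γ.arc e t)) :
    (0 < (conj (deriv (Γ.arc e) t) / deriv (Γ.arc f) u).re → ∀ F,
      (Γ.LeftOf e F → Γ.RightOf f (hΓ.mirror F)) ∧ (Γ.RightOf e F → Γ.LeftOf f (hΓ.mirror F))) ∧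
    ((conj (deriv (Γ.arc e) t) / deriv (Γ.arc f) u).re < 0 → ∀ F,
      (Γ.LeftOf e F → Γ.LeftOf f (hΓ.mirror F)) ∧
        (Γ.RightOf e F → Γ.RightOf f (hΓ.mirror F))) := by
  set D := conj (deriv (Γ.arc e) t) with hD
  have hz1 : HasDerivAt (fun s : ℝ => conj (Γ.arc e t + s * (Complex.I * deriv (Γ.arc e) t)))
      (-Complex.I * D) 0 := by
    have : HasDerivAt (fun s : ℝ => Γ.arc e t + s * (Complex.I * deriv (Γ.arc e) t))
        (1 * (Complex.I * deriv (Γ.arc e) t)) 0 :=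
      ((Complex.ofRealCLM.hasDerivAt (x := (0 : ℝ))).mul_const _).const_add _
    have := this.conj_comp
    rwa [one_mul, map_mul, Complex.conj_I] at this
  have hz2 : HasDerivAt (fun s : ℝ => conj (Γ.arc e t - s * (Complex.I * deriv (Γ.arc e) t)))
      (Complex.I * D) 0 := by
    have : HasDerivAt (fun s : ℝ => Γ.arc e t - s * (Complex.I * deriv (Γ.arc e) t))
        (-(1 * (Complex.I * deriv (Γ.arc e) t))) 0 :=
      ((Complex.ofRealCLM.hasDerivAt (x := (0 : ℝ))).mul_const _).const_sub _
    have := this.conj_comp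
    rwa [one_mul, map_neg, map_mul, Complex.conj_I, neg_mul, neg_neg] at this
  have hi1 : (-Complex.I * D / deriv (Γ.arc f) u).im = -(D / deriv (Γ.arc f) u).re := by
    rw [mul_div_assoc]
    simp
  have hi2 : (Complex.I * D / deriv (Γ.arc f) u).im = (D / deriv (Γ.arc f) u).re := by
    rw [mul_div_assoc]
    simp
  have key : ∀ {F G : Γ.Face} {z : ℝ → ℂ}, (∀ᶠ s in 𝓝[>] (0 : ℝ), z s ∈ F.1) →
      (∀ᶠ s in 𝓝[>] (0 : ℝ), conj (z s) ∈ G.1) → hΓ.mirror F = G := by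
    intro F G z h1 h2
    obtain ⟨s, hs1, hs2⟩ := (h1.and h2).exists
    exact Face.eq_of_mem (hΓ.conj_mem_mirror hs1) hs2
  obtain ⟨L, hL⟩ := exists_leftOf f
  obtain ⟨R, hR⟩ := exists_rightOf f
  refine ⟨fun hp F => ⟨fun hF => ?_, fun hF => ?_⟩, fun hp F => ⟨fun hF => ?_, fun hF => ?_⟩⟩
  · rwa [key (hF t ht) (hR.eventually_gt hu hz1 (by simp [h]) (by linarith))]
  · rwa [key (hF t ht) (hL.eventually_gt hu hz2 (by simp [h]) (by linarith))]
  · rwa [key (hF t ht) (hL.eventually_gt hu hz1 (by simp [h]) (by linarith))]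
  · rwa [key (hF t ht) (hR.eventually_gt hu hz2 (by simp [h]) (by linarith))]

/-- The reflection of an edge either preserves its direction and interchanges the two sides, or
reverses its direction and preserves the two sides. -/
theorem mirrorEdge_cases (hΓ : Γ.IsMoveSymmetric) (e : Γ.Edge) :
    ((∀ b, Γ.endpoint (hΓ.mirrorEdge e) b = conj (Γ.endpoint e b)) ∧ ∀ F,
      (Γ.LeftOf e F → Γ.RightOf (hΓ.mirrorEdge e) (hΓ.mirror F)) ∧
      (Γ.RightOf e F → Γ.LeftOf (hΓ.mirrorEdge e) (hΓ.mirror F))) ∨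
    ((∀ b, Γ.endpoint (hΓ.mirrorEdge e) b = conj (Γ.endpoint e !b)) ∧ ∀ F,
      (Γ.LeftOf e F → Γ.LeftOf (hΓ.mirrorEdge e) (hΓ.mirror F)) ∧
      (Γ.RightOf e F → Γ.RightOf (hΓ.mirrorEdge e) (hΓ.mirror F))) := by
  set f := hΓ.mirrorEdge e
  obtain ⟨τ, hm, hτ, hc, hi⟩ := exists_reparametrisation hΓ.conj_mem_internal
    (hΓ.edgeSet_mirrorEdge e)
  have hmid : (1 / 2 : ℝ) ∈ Ioo (0 : ℝ) 1 := by norm_num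
  have hτm := hm hmid
  have hside := hΓ.mirror_side hmid hτm (hτ _ hmid)
  have hev0 : ∀ᶠ t in 𝓝[Ioo 0 1] (cond false 1 0 : ℝ), t ∈ Ioo (0 : ℝ) 1 ∧ t < 1 / 2 := by
    filter_upwards [self_mem_nhdsWithin, mem_nhdsWithin_of_mem_nhds
      (Iio_mem_nhds (show (cond false 1 0 : ℝ) < 1 / 2 by norm_num))] with t h1 h2 using ⟨h1, h2⟩
  have hev1 : ∀ᶠ t in 𝓝[Ioo 0 1] (cond true 1 0 : ℝ), t ∈ Ioo (0 : ℝ) 1 ∧ 1 / 2 < t := by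
    filter_upwards [self_mem_nhdsWithin, mem_nhdsWithin_of_mem_nhds
      (Ioi_mem_nhds (show 1 / 2 < (cond true 1 0 : ℝ) by norm_num))] with t h1 h2 using ⟨h1, h2⟩
  have hsmall : ∀ B : Bool, (∀ᶠ t in 𝓝[Ioo 0 1] (cond B 1 0 : ℝ), τ t ∈ Icc 0 (τ (1 / 2))) →
      Γ.endpoint f false = conj (Γ.endpoint e B) := by
    intro B hB
    have := endpoint_eq_of_eventually hΓ.conj_mem_internal hτ le_rfl hτm.2.le (Or.inr hτm.2) B hB
    rwa [if_neg (lt_irrefl _)] at this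
  have hlarge : ∀ B : Bool, (∀ᶠ t in 𝓝[Ioo 0 1] (cond B 1 0 : ℝ), τ t ∈ Icc (τ (1 / 2)) 1) →
      Γ.endpoint f true = conj (Γ.endpoint e B) := by
    intro B hB
    have := endpoint_eq_of_eventually hΓ.conj_mem_internal hτ hτm.1.le le_rfl (Or.inl hτm.1) B hB
    rwa [if_pos hτm.1] at this
  -- A continuous injective `τ` is monotone. If it increases, the direction is kept and the sides
  -- are exchanged, because conjugation reverses orientation; if it decreases, the two effects on
  -- the sides cancel.
  rcases hc.strictMonoOn_of_injOn_Ioo zero_lt_one hi with hmo | hmo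
  · left
    have hpos := conj_deriv_div hm hτ hc hi (one_ne_zero (α := ℝ)) (fun s hs t ht hst => by
      rw [one_mul]
      rcases lt_or_gt_of_ne hst with h | h
      · exact div_nonneg_of_nonpos (by linarith [hmo hs ht h]) (by linarith)
      · exact div_nonneg (by linarith [hmo ht hs h]) (by linarith)) hmid
    rw [one_mul] at hpos
    refine ⟨?_, hside.1 hpos⟩
    rintro (_ | _)
    · refine hsmall false ?_
      filter_upwards [hev0] with t ht using ⟨(hm ht.1).1.le, (hmo ht.1 hmid ht.2).le⟩
    · refine hlarge true ?_
      filter_upwards [hev1] with t ht using ⟨(hmo hmid ht.1 ht.2).le, (hm ht.1).2.le⟩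
  · right
    have hneg := conj_deriv_div hm hτ hc hi (neg_ne_zero.2 (one_ne_zero (α := ℝ)))
      (fun s hs t ht hst => by
        rw [neg_one_mul, ← neg_div]
        rcases lt_or_gt_of_ne hst with h | h
        · exact div_nonneg_of_nonpos (by linarith [hmo hs ht h]) (by linarith)
        · exact div_nonneg (by linarith [hmo ht hs h]) (by linarith)) hmid
    refine ⟨?_, hside.2 (by linarith)⟩
    rintro (_ | _)
    · refine hsmall true ?_
      filter_upwards [hev1] with t ht using ⟨(hm ht.1).1.le, (hmo hmid ht.1 ht.2).le⟩
    · refine hlarge false ?_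
      filter_upwards [hev0] with t ht using ⟨(hmo ht.1 hmid ht.2).le, (hm ht.1).2.le⟩

/-- The reflection in the midline reverses the arrows at the squares on the midline. -/
theorem arrow_mirrorEdge (hΓ : Γ.IsMoveSymmetric) {e : Γ.Edge} {F G : Γ.Face}
    (h : Γ.Arrow e F G) (hFG : Γ.IsMidSquare F ∨ Γ.IsMidSquare G) :
    Γ.Arrow (hΓ.mirrorEdge e) (hΓ.mirror G) (hΓ.mirror F) := by
  -- Both endpoints are vertices of a square and so keep their colours; reversal of orientation is
  -- then the only effect on the arrow.
  have hs : ∀ b, Γ.endpoint e b ∈ Γ.squareVertices := by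
    intro b
    simp only [squareVertices, mem_iUnion]
    rcases hFG with hF | hG
    · exact ⟨F, hF, endpoint_mem_corners h.sides.1 b⟩
    · exact ⟨G, hG, endpoint_mem_corners h.sides.2 b⟩
  rcases hΓ.mirrorEdge_cases e with ⟨he, hF⟩ | ⟨he, hF⟩
  · rw [Arrow, he, he, hΓ.blackToWhite_conj_iff (hs _) (hs _),
      hΓ.blackToWhite_conj_iff (hs _) (hs _)]
    rcases h with ⟨h1, h2, h3⟩ | ⟨h1, h2, h3⟩
    · exact Or.inl ⟨h1, (hF G).2 h3, (hF F).1 h2⟩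
    · exact Or.inr ⟨h1, (hF G).1 h3, (hF F).2 h2⟩
  · rw [Arrow, he, he, Bool.not_false, Bool.not_true, hΓ.blackToWhite_conj_iff (hs _) (hs _),
      hΓ.blackToWhite_conj_iff (hs _) (hs _)]
    rcases h with ⟨h1, h2, h3⟩ | ⟨h1, h2, h3⟩
    · exact Or.inr ⟨h1, (hF G).2 h3, (hF F).1 h2⟩
    · exact Or.inl ⟨h1, (hF G).1 h3, (hF F).2 h2⟩

end IsMoveSymmetric

/-! ### Counting arrows at the squares and across the midline -/

/-- The number of edges with a dual arrow or half-arrow from `F` to `G`. -/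
def arrowCount (F G : Γ.Face) : ℕ := Nat.card {e // Γ.Arrow e F G}

theorem IsMoveSymmetric.arrowCount_mirror (hΓ : Γ.IsMoveSymmetric) {F G : Γ.Face}
    (hFG : Γ.IsMidSquare F ∨ Γ.IsMidSquare G) :
    arrowCount (hΓ.mirror G) (hΓ.mirror F) = arrowCount F G := by
  have key : ∀ {F G : Γ.Face}, (Γ.IsMidSquare F ∨ Γ.IsMidSquare G) →
      arrowCount F G ≤ arrowCount (hΓ.mirror G) (hΓ.mirror F) := by
    intro F G hFG
    refine Nat.card_le_card_of_injective
      (fun e => ⟨hΓ.mirrorEdge e.1, hΓ.arrow_mirrorEdge e.2 hFG⟩) ?_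
    intro e f h
    exact Subtype.ext (hΓ.mirrorEdge_injective (congrArg Subtype.val h))
  refine le_antisymm ?_ (key hFG)
  have := key (F := hΓ.mirror G) (G := hΓ.mirror F) (by
    rw [hΓ.isMidSquare_mirror, hΓ.isMidSquare_mirror]
    exact hFG.symm)
  simpa using this

theorem BlackToWhite.asymm {u v : ℂ} (h : Γ.BlackToWhite u v) : ¬ Γ.BlackToWhite v u := by
  have hd : ∀ z, z ∈ Γ.black → z ∉ Γ.white := fun z h h' =>
    Finset.disjoint_left.1 Γ.disjoint_colors h h'
  have h1 := hd u
  have h2 := hd v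
  unfold BlackToWhite at *
  tauto

theorem endpoint_mem_internal_of_movable {e : Γ.Edge} {k : Γ.Face} (hk : Γ.IsMovable k)
    (h : Γ.LeftOf e k ∨ Γ.RightOf e k) (b : Bool) : Γ.endpoint e b ∈ Γ.internal := by
  have := hk.2 e (side_subset_frontier h)
  simp only [internal, Finset.mem_union]
  cases b <;> tauto

/-- All edges along a movable face join coloured vertices, so no half-arrows occur there. -/
theorem arrows_eq_arrowCount {F G : Γ.Face} (h : Γ.IsMovable F ∨ Γ.IsMovable G) :
    Γ.arrows F G = arrowCount F G := by
  classical
  have h1 : ∀ e, (if Γ.Arrow e F G then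
      (if ∀ b, Γ.endpoint e b ∈ Γ.internal then (1 : ℚ) else 1 / 2) else 0) =
      if Γ.Arrow e F G then 1 else 0 := by
    intro e
    split_ifs with h2 h3 <;> try rfl
    refine absurd (fun b => ?_) h3
    rcases h with h | h
    · exact endpoint_mem_internal_of_movable h h2.sides.1 b
    · exact endpoint_mem_internal_of_movable h h2.sides.2 b
  unfold arrows arrowCount
  rw [Nat.card_eq_fintype_card, Fintype.card_subtype, Finset.card_filter]
  push_cast
  exact Finset.sum_congr rfl fun e _ => by convert h1 e

/-- Different squares have no common vertices, and an edge of a single square has it on exactly one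
side. -/
theorem not_side_both_squares (hΓ : Γ.IsMoveSymmetric) {e : Γ.Edge} {F G : Γ.Face}
    (hF : Γ.IsMidSquare F) (hG : Γ.IsMidSquare G) : ¬ Γ.Arrow e F G := by
  intro h
  by_cases hFG : F = G
  · subst hFG
    obtain ⟨-, v, f, -, -, hfr, hx, -⟩ := id hF
    obtain ⟨i, rfl⟩ := edge_eq_of_subset ((side_subset_frontier h.sides.1).trans hfr.subset)
    have := hx i
    rcases h with ⟨-, h1, h2⟩ | ⟨-, h1, h2⟩ <;> simp [h1, h2] at this
  · exact disjoint_left.1 (hΓ.independent F G hF hG hFG) (endpoint_mem_corners h.sides.1 true)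
      (endpoint_mem_corners h.sides.2 true)

theorem q_eq_zero_of_squares (hΓ : Γ.IsMoveSymmetric) {F G : Γ.Face}
    (hF : Γ.IsMidSquare F) (hG : Γ.IsMidSquare G) : Γ.q F G = 0 := by
  simp [q, arrows, not_side_both_squares hΓ hF hG, not_side_both_squares hΓ hG hF]

/-- The four edges of a square have one dual arrow each, to or from another face. -/
theorem sum_arrowCount_square (hΓ : Γ.IsMoveSymmetric) {k : Γ.Face} (hk : Γ.IsMidSquare k) :
    ∑ i, (arrowCount i k + arrowCount k i) = 4 := by
  classical
  obtain ⟨-, v, f, hv, hends, hfr, hx, -⟩ := id hk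
  -- Two equal edges in opposite directions would give `i = j + 1` and `i + 1 = j` in `Fin 4`, which
  -- is impossible.
  have hf : Function.Injective f := by
    intro i j hij
    have h1 := hends i
    have h2 := hends j
    rw [hij] at h1
    rcases h1 with ⟨h1, h1'⟩ | ⟨h1, h1'⟩ <;> rcases h2 with ⟨h2, h2'⟩ | ⟨h2, h2'⟩
    · exact hv (h1.symm.trans h2)
    · have h3 := hv (h1.symm.trans h2')
      have h4 := hv (h1'.symm.trans h2)
      omega
    · have h3 := hv (h1.symm.trans h2')
      have h4 := hv (h1'.symm.trans h2)
      omega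
    · exact hv (h1.symm.trans h2)
  -- Alternating colours give the edge a dual arrow in exactly one direction; `i` is the face across
  -- the edge.
  have hone : ∀ m, ∃ i, ∀ j, (if Γ.Arrow (f m) j k then 1 else 0) +
      (if Γ.Arrow (f m) k j then 1 else 0) = if j = i then 1 else 0 := by
    intro m
    have hc := (hΓ.movable k hk).2 (f m) (hfr ▸ subset_iUnion (fun i => Γ.edgeSet (f i)) m)
    have hb : Γ.BlackToWhite (Γ.endpoint (f m) false) (Γ.endpoint (f m) true) ∨
        Γ.BlackToWhite (Γ.endpoint (f m) true) (Γ.endpoint (f m) false) := by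
      have hd : ∀ z, z ∈ Γ.black → z ∉ Γ.white := fun z h h' =>
        Finset.disjoint_left.1 Γ.disjoint_colors h h'
      have h1 := hd (Γ.endpoint (f m) false)
      have h2 := hd (Γ.endpoint (f m) true)
      unfold BlackToWhite
      tauto
    rcases hx m with ⟨h1, h2⟩ | ⟨h1, h2⟩
    · obtain ⟨i, hi⟩ := exists_rightOf (f m)
      refine ⟨i, fun j => ?_⟩
      have hj : Γ.RightOf (f m) j ↔ j = i := ⟨fun h => h.unique hi, fun h => h ▸ hi⟩
      rcases hb with hb | hb <;> simp [Arrow, h1, h2, hj, hb, hb.asymm]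
    · obtain ⟨i, hi⟩ := exists_leftOf (f m)
      refine ⟨i, fun j => ?_⟩
      have hj : Γ.LeftOf (f m) j ↔ j = i := ⟨fun h => h.unique hi, fun h => h ▸ hi⟩
      rcases hb with hb | hb <;> simp [Arrow, h1, h2, hj, hb, hb.asymm]
  choose i hi using hone
  have hzero : ∀ e, e ∉ Finset.univ.image f → ∀ j, (if Γ.Arrow e j k then 1 else 0) +
      (if Γ.Arrow e k j then 1 else 0) = 0 := by
    intro e he j
    have hn : ¬ (Γ.LeftOf e k ∨ Γ.RightOf e k) := by
      intro h
      obtain ⟨m, hm⟩ := edge_eq_of_subset ((side_subset_frontier h).trans hfr.subset)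
      exact he (Finset.mem_image.2 ⟨m, Finset.mem_univ _, hm⟩)
    rw [if_neg fun h => hn h.sides.2, if_neg fun h => hn h.sides.1]
  have hcount : ∀ j, arrowCount j k + arrowCount k j =
      ∑ e, ((if Γ.Arrow e j k then 1 else 0) + (if Γ.Arrow e k j then 1 else 0)) := by
    intro j
    rw [Finset.sum_add_distrib, arrowCount, arrowCount, Nat.card_eq_fintype_card,
      Nat.card_eq_fintype_card, Fintype.card_subtype, Fintype.card_subtype, Finset.card_filter,
      Finset.card_filter]
  rw [Finset.sum_congr rfl fun j _ => hcount j, Finset.sum_comm,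
    ← Finset.sum_subset (Finset.subset_univ (Finset.univ.image f))
      (fun e _ he => Finset.sum_eq_zero fun j _ => hzero e he j),
    Finset.sum_image (fun a _ b _ h => hf h)]
  simp [hi]

/-- An edge between a face above the midline and a face below it lies on the midline. -/
theorem eq_mirror_of_side (hΓ : Γ.IsMoveSymmetric) {e : Γ.Edge} {i j : Γ.Face} (hi : IsUpper i)
    (hj : IsUpper j) (h : (Γ.LeftOf e i ∧ Γ.RightOf e (hΓ.mirror j)) ∨
      (Γ.RightOf e i ∧ Γ.LeftOf e (hΓ.mirror j))) : i = j := by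
  have hcl1 : closure i.1 ⊆ {z | 0 ≤ z.im} :=
    closure_minimal (fun z hz => (hi z hz).le) (isClosed_le continuous_const Complex.continuous_im)
  have hcl2 : closure (hΓ.mirror j).1 ⊆ {z | z.im ≤ 0} := by
    refine closure_minimal ?_ (isClosed_le Complex.continuous_im continuous_const)
    rintro _ ⟨z, hz, rfl⟩
    simpa using (hj z hz).le
  have hreal : ∀ t ∈ Icc (0 : ℝ) 1, (Γ.arc e t).im = 0 := by
    intro t ht
    have hm : Γ.arc e t ∈ Γ.edgeSet e := ⟨t, ht, rfl⟩
    refine le_antisymm (hcl2 (frontier_subset_closure (side_subset_frontier ?_ hm)))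
      (hcl1 (frontier_subset_closure (side_subset_frontier ?_ hm)))
    · tauto
    · tauto
  have hmid : (1 / 2 : ℝ) ∈ Ioo (0 : ℝ) 1 := by norm_num
  -- The edge lies in the closures of an upper and a lower face, hence on the real axis. With real
  -- point and real tangent, conjugation exchanges the two normals, so the faces on the two sides
  -- are mirror images.
  have hder : (deriv (Γ.arc e) (1 / 2)).im = 0 := by
    have h1 : HasDerivAt (fun t => (Γ.arc e t).im) (deriv (Γ.arc e) (1 / 2)).im (1 / 2) :=
      Complex.imCLM.hasFDerivAt.comp_hasDerivAt (1 / 2 : ℝ) (hasDerivAt_arc e (1 / 2))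
    have h2 : (fun t => (Γ.arc e t).im) =ᶠ[𝓝 (1 / 2)] fun _ => 0 := by
      filter_upwards [isOpen_Ioo.mem_nhds hmid] with t ht using hreal t ⟨ht.1.le, ht.2.le⟩
    exact (h1.congr_of_eventuallyEq h2.symm).unique (hasDerivAt_const _ _)
  have hc1 := Complex.conj_eq_iff_im.2 (hreal _ ⟨hmid.1.le, hmid.2.le⟩)
  have hc2 := Complex.conj_eq_iff_im.2 hder
  have key : ∀ {F G : Γ.Face}, Γ.LeftOf e F → Γ.RightOf e G → hΓ.mirror F = G := by
    intro F G h1 h2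
    obtain ⟨s, hs1, hs2⟩ := ((h1 _ hmid).and (h2 _ hmid)).exists
    refine Face.eq_of_mem (hΓ.conj_mem_mirror hs1) ?_
    convert hs2 using 1
    rw [map_add, map_mul, map_mul, hc1, hc2, Complex.conj_I, Complex.conj_ofReal]
    ring
  rcases h with ⟨h1, h2⟩ | ⟨h1, h2⟩
  · have := congrArg hΓ.mirror (key h1 h2)
    simpa using this
  · simpa using (key h2 h1).symm

theorem q_swap (F G : Γ.Face) : Γ.q F G = -Γ.q G F := by simp [q]

/-- For `i = j` this is skew-symmetry. Otherwise `eq_mirror_of_side` excludes any edge between an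
upper face and the mirror image of a different one, so both terms vanish. -/
theorem q_mirror_add (hΓ : Γ.IsMoveSymmetric) {i j : Γ.Face} (hi : IsUpper i) (hj : IsUpper j) :
    Γ.q i (hΓ.mirror j) + Γ.q (hΓ.mirror i) j = 0 := by
  by_cases hij : i = j
  · subst hij
    rw [q_swap (hΓ.mirror i)]
    ring
  · have h0 : ∀ {i j : Γ.Face}, IsUpper i → IsUpper j → i ≠ j → ∀ e,
        ¬ Γ.Arrow e i (hΓ.mirror j) ∧ ¬ Γ.Arrow e (hΓ.mirror j) i := by
      intro i j hi hj hij e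
      constructor <;> rintro (h | h) <;> refine hij (eq_mirror_of_side hΓ hi hj (e := e) ?_) <;>
        tauto
    simp [q, arrows, h0 hi hj hij, h0 hj hi (Ne.symm hij)]

/-! ### The graph near a vertex -/

theorem eq_of_locally_eq {α : Type*} {χ : ℝ → α} {S : Set ℝ} (hS : IsPreconnected S)
    (h : ∀ x ∈ S, ∀ᶠ y in 𝓝[S] x, χ y = χ x) {x y : ℝ} (hx : x ∈ S) (hy : y ∈ S) : χ x = χ y :=
  hS.induction₂' (fun x y => χ x = χ y)
    (fun x hx => by filter_upwards [h x hx] with y hy using ⟨hy.symm, hy⟩)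
    (fun _ _ _ _ _ _ h h' => h.trans h') hx hy

/-- The increment of a piecewise constant function is the sum of its jumps. -/
theorem sub_eq_sum_jumps {ι : Type*} (s : Finset ι) (θ : ι → ℝ) (hθ : InjOn θ s) (χ : ℝ → ℤ)
    (l r : ι → ℤ) (a b : ℝ) (hab : a ≤ b) (hmem : ∀ i ∈ s, θ i ∈ Ioo a b)
    (hl : ∀ i ∈ s, ∀ᶠ x in 𝓝[<] (θ i), χ x = l i) (hr : ∀ i ∈ s, ∀ᶠ x in 𝓝[>] (θ i), χ x = r i)
    (hloc : ∀ x ∈ Icc a b, (∀ i ∈ s, θ i ≠ x) → ∀ᶠ y in 𝓝 x, χ y = χ x) :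
    χ b - χ a = ∑ i ∈ s, (r i - l i) := by
  classical
  induction s using Finset.induction_on_max_value θ generalizing b with
  | empty =>
    rw [Finset.sum_empty, sub_eq_zero]
    exact eq_of_locally_eq isPreconnected_Icc
      (fun x hx => mem_nhdsWithin_of_mem_nhds (hloc x hx (by simp)))
      (right_mem_Icc.2 hab) (left_mem_Icc.2 hab)
  | insert m s hm hmax ih =>
    have hmm := hmem m (Finset.mem_insert_self m s)
    have hlt : ∀ i ∈ s, θ i < θ m := fun i hi => lt_of_le_of_ne (hmax i hi) fun h =>
      hm (hθ (Finset.mem_insert_of_mem hi) (Finset.mem_insert_self m s) h ▸ hi)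
    have hev : ∀ᶠ x in 𝓝[<] (θ m), ∀ i ∈ s, θ i < x := by
      rw [Filter.eventually_all_finset]
      intro i hi
      exact mem_nhdsWithin_of_mem_nhds (Ioi_mem_nhds (hlt i hi))
    -- The largest jump is split off: `b'` lies just before it and after all others, so the
    -- induction hypothesis applies on `[a, b']`; after the jump the function is constant up to `b`.
    obtain ⟨b', ⟨hb1, hb2⟩, hb3, hb4⟩ := (((hl m (Finset.mem_insert_self m s)).and hev).and
      (Ioo_mem_nhdsLT hmm.1)).exists
    have h1 := ih (hθ.mono (by simp)) b' hb3.le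
      (fun i hi => ⟨(hmem i (Finset.mem_insert_of_mem hi)).1, hb2 i hi⟩)
      (fun i hi => hl i (Finset.mem_insert_of_mem hi))
      (fun i hi => hr i (Finset.mem_insert_of_mem hi))
      (fun x hx hne => hloc x ⟨hx.1, hx.2.trans (hb4.le.trans hmm.2.le)⟩ fun i hi => by
        rcases Finset.mem_insert.1 hi with rfl | hi
        · exact (hx.2.trans_lt hb4).ne'
        · exact hne i hi)
    obtain ⟨c, hc1, hc2, hc3⟩ := ((hr m (Finset.mem_insert_self m s)).and
      (Ioo_mem_nhdsGT hmm.2)).exists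
    have h2 : χ c = χ b := eq_of_locally_eq (isPreconnected_Ioc (a := θ m) (b := b))
      (fun x hx => mem_nhdsWithin_of_mem_nhds
        (hloc x ⟨(hmm.1.trans hx.1).le, hx.2⟩ fun i hi => by
          rcases Finset.mem_insert.1 hi with rfl | hi
          · exact hx.1.ne
          · exact ((hlt i hi).trans hx.1).ne)) ⟨hc2, hc3.le⟩ ⟨hmm.2, le_rfl⟩
    rw [Finset.sum_insert hm, ← h1, ← h2, hc1, hb1]
    ring

/-- A regular arc starting at `v` goes away from `v` for some time. -/
theorem exists_strictMonoOn_norm_sub {β : ℝ → ℂ} (hβ : ContDiff ℝ 1 β) {v : ℂ} (h0 : β 0 = v)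
    (hd : deriv β 0 ≠ 0) : ∃ ε > 0, ε < 1 / 2 ∧
      (∀ s ∈ Ioo 0 ε, 0 < ((β s - v) * conj (deriv β s)).re) ∧
      StrictMonoOn (fun s => ‖β s - v‖) (Icc 0 ε) := by
  have hder : ∀ s, HasDerivAt β (deriv β s) s := fun s =>
    (hβ.differentiable one_ne_zero s).hasDerivAt
  have h1 : Tendsto (slope β 0) (𝓝[>] 0) (𝓝 (deriv β 0)) :=
    (hasDerivAt_iff_tendsto_slope.1 (hder 0)).mono_left
      (nhdsWithin_mono 0 (fun u (hu : 0 < u) => hu.ne'))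
  have h2 : Tendsto (fun s => conj (deriv β s)) (𝓝[>] 0) (𝓝 (conj (deriv β 0))) :=
    ((Complex.continuous_conj.comp (hβ.continuous_deriv le_rfl)).tendsto 0).mono_left
      nhdsWithin_le_nhds
  -- Up to the factor `s / 2`, this is the derivative of `|β s - v|²`; its limit `|β'(0)|²` is
  -- positive.
  have h3 := (Complex.continuous_re.tendsto _).comp (h1.mul h2)
  have h4 : 0 < (deriv β 0 * conj (deriv β 0)).re := by
    rw [Complex.mul_conj, Complex.ofReal_re]
    exact Complex.normSq_pos.2 hd
  obtain ⟨δ, hδ, hδ'⟩ := mem_nhdsGT_iff_exists_Ioo_subset.1 (h3.eventually (lt_mem_nhds h4))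
  have hpos : ∀ s ∈ Ioo 0 δ, 0 < ((β s - v) * conj (deriv β s)).re := by
    intro s hs
    have h5 : 0 < (slope β 0 s * conj (deriv β s)).re := hδ' hs
    have h6 : β s - v = (s : ℝ) * slope β 0 s := by
      rw [slope_def_module, ← Complex.real_smul, smul_smul, sub_zero, mul_inv_cancel₀ hs.1.ne',
        one_smul, h0]
    rw [h6, mul_assoc, Complex.re_ofReal_mul]
    exact mul_pos hs.1 h5
  have hδ0 : 0 < δ := hδ
  refine ⟨min (δ / 2) (1 / 4), by positivity, ?_, ?_, ?_⟩
  · exact (min_le_right _ _).trans_lt (by norm_num)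
  · intro s hs
    refine hpos s ⟨hs.1, hs.2.trans_le ((min_le_left _ _).trans (by linarith))⟩
  · have hsq : StrictMonoOn (fun s => ‖β s - v‖ ^ 2) (Icc 0 (min (δ / 2) (1 / 4))) := by
      refine strictMonoOn_of_deriv_pos (convex_Icc _ _) ?_ ?_
      · exact ((hβ.continuous.sub continuous_const).norm.pow 2).continuousOn
      · intro s hs
        rw [interior_Icc] at hs
        have h5 := ((hder s).sub_const v).norm_sq
        rw [h5.deriv, Complex.inner]
        have h6 := hpos s ⟨hs.1, hs.2.trans_le ((min_le_left _ _).trans (by linarith))⟩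
        have h7 : (deriv β s * conj (β s - v)).re = ((β s - v) * conj (deriv β s)).re := by
          simp [Complex.mul_re]
          ring
        linarith
    intro s hs t ht hst
    exact lt_of_pow_lt_pow_left₀ 2 (norm_nonneg _) (hsq hs ht hst)

/-- The circles of small radius around a vertex meet the graph exactly once on each half-edge at
the vertex, and transversely. -/
theorem exists_circle {v : ℂ} (hv : v ∈ Γ.internal) : ∃ r > 0, ∃ t : Γ.Edge × Bool → ℝ,
    Metric.sphere v r ⊆ openRect ∧
    (∀ p, Γ.endpoint p.1 p.2 = v → t p ∈ Ioo (0 : ℝ) 1 ∧ ‖Γ.arc p.1 (t p) - v‖ = r ∧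
      0 < (cond p.2 (-1) 1) * ((Γ.arc p.1 (t p) - v) * conj (deriv (Γ.arc p.1) (t p))).re) ∧
    ∀ z ∈ Γ.carrier, ‖z - v‖ = r → ∃ p, Γ.endpoint p.1 p.2 = v ∧ Γ.arc p.1 (t p) = z := by
  -- `β p` runs along the half-edge `p` away from its own endpoint; `φ b` is the identity or the
  -- reversal of `[0, 1]`, an involution.
  set φ : Bool → ℝ → ℝ := fun b s => cond b (1 - s) s with hφ
  have hφφ : ∀ b s, φ b (φ b s) = s := by
    rintro (_ | _) s <;> simp [hφ]
  set β : Γ.Edge × Bool → ℝ → ℂ := fun p s => Γ.arc p.1 (φ p.2 s) with hβ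
  have hφd : ∀ b s, HasDerivAt (φ b) (cond b (-1) 1) s := by
    rintro (_ | _) s
    · exact hasDerivAt_id s
    · exact (hasDerivAt_id s).const_sub 1
  have hβc : ∀ p, ContDiff ℝ 1 (β p) := by
    rintro ⟨e, _ | _⟩
    · exact Γ.arc_contDiff e
    · exact (Γ.arc_contDiff e).comp (contDiff_const.sub contDiff_id)
  have hβd : ∀ p s, deriv (β p) s = (cond p.2 (-1) 1 : ℝ) * deriv (Γ.arc p.1) (φ p.2 s) := by
    intro p s
    have := (hasDerivAt_arc p.1 (φ p.2 s)).scomp s (hφd p.2 s)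
    rw [Complex.real_smul] at this
    exact this.deriv
  have hβ0 : ∀ p, β p 0 = Γ.endpoint p.1 p.2 := by
    rintro ⟨e, _ | _⟩ <;> simp [hβ, hφ, endpoint]
  have hne : ∀ p, deriv (β p) 0 ≠ 0 := by
    rintro ⟨e, b⟩
    rw [hβd]
    refine mul_ne_zero ?_ (Γ.arc_regular e _ ?_)
    · cases b <;> simp
    · cases b <;> simp [hφ]
  choose ε hε hε2 hpos hmono using fun p => exists_strictMonoOn_norm_sub (hβc p) rfl (hne p)
  -- `A e` consists of the parameters on initial pieces of half-edges at `v`. With these and `v`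
  -- removed, the graph is contained in the closed set `K`, which a small disc around `v` misses.
  set A : Γ.Edge → Set ℝ := fun e => {t | ∃ b, Γ.endpoint e b = v ∧ φ b t < ε (e, b)} with hA
  have hAo : ∀ e, IsOpen (A e) := by
    intro e
    have : A e = ⋃ b, ⋃ (_ : Γ.endpoint e b = v), φ b ⁻¹' Iio (ε (e, b)) := by
      ext t
      simp [hA]
    rw [this]
    refine isOpen_iUnion fun b => isOpen_iUnion fun _ => isOpen_Iio.preimage ?_
    exact continuous_iff_continuousAt.2 fun s => (hφd b s).continuousAt
  set K : Set ℂ := (↑(Γ.internal.erase v) : Set ℂ) ∪ ⋃ e, Γ.arc e '' (Icc 0 1 \ A e) with hK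
  have hKc : IsClosed K := (Finset.finite_toSet _).isClosed.union
    (isClosed_iUnion_of_finite fun e =>
      ((isCompact_Icc.diff (hAo e)).image (Γ.arc_contDiff e).continuous).isClosed)
  have hvr : v ∈ openRect := Γ.internal_mem v hv
  have hvK : v ∉ K := by
    rintro (h | h)
    · simp at h
    · obtain ⟨e, t, ⟨ht, htA⟩, hte⟩ := mem_iUnion.1 h
      rcases eq_or_lt_of_le ht.1 with h0 | h0
      · refine htA ⟨false, ?_, ?_⟩
        · rw [← hte, ← h0]
          rfl
        · rw [← h0]
          exact hε (e, false)
      rcases eq_or_lt_of_le ht.2 with h1 | h1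
      · refine htA ⟨true, ?_, ?_⟩
        · rw [← hte, h1]
          rfl
        · rw [h1]
          simpa [hφ] using hε (e, true)
      exact (Γ.arc_mem e t ⟨h0, h1⟩).2 (hte ▸ hv)
  obtain ⟨r₀, hr₀, hb⟩ := Metric.isOpen_iff.1 (isOpen_openRect.sdiff hKc) v ⟨hvr, hvK⟩
  have hbK : ∀ z, ‖z - v‖ < r₀ → z ∈ openRect ∧ z ∉ K := fun z hz => hb (mem_ball_iff_norm.2 hz)
  have hs : ∀ p, Γ.endpoint p.1 p.2 = v → ∃ s ∈ Ioo 0 (ε p), ‖β p s - v‖ = r₀ / 2 := by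
    intro p hp
    have hfar : r₀ ≤ ‖β p (ε p) - v‖ := by
      by_contra hc
      push Not at hc
      refine (hbK _ hc).2 (Or.inr (mem_iUnion.2 ⟨p.1, φ p.2 (ε p), ⟨?_, ?_⟩, rfl⟩))
      · have h1 := hε p
        have h2 := hε2 p
        obtain ⟨e, _ | _⟩ := p
        · constructor <;> simp only [hφ, cond_false] <;> linarith
        · constructor <;> simp only [hφ, cond_true] <;> linarith
      · rintro ⟨b, -, h⟩
        have h2 := hε2 p
        have h3 := hε2 (p.1, b)
        -- The bound `ε < 1 / 2` keeps the initial pieces of the two half-edges of a loop apart.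
        have h4 : b = p.2 ∨ φ b (φ p.2 (ε p)) = 1 - ε p := by
          obtain ⟨e, _ | _⟩ := p <;> cases b <;> simp [hφ]
        rcases h4 with rfl | h4
        · rw [hφφ] at h
          exact lt_irrefl _ h
        · linarith
    have hc : ContinuousOn (fun s => ‖β p s - v‖) (Icc 0 (ε p)) :=
      ((hβc p).continuous.sub continuous_const).norm.continuousOn
    obtain ⟨s, hs, hse⟩ := intermediate_value_Icc (hε p).le hc
      (show r₀ / 2 ∈ Icc (‖β p 0 - v‖) (‖β p (ε p) - v‖) by
        rw [hβ0, hp, sub_self, norm_zero]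
        constructor <;> linarith)
    have hse' : ‖β p s - v‖ = r₀ / 2 := hse
    refine ⟨s, ⟨lt_of_le_of_ne hs.1 ?_, lt_of_le_of_ne hs.2 ?_⟩, hse⟩
    · rintro rfl
      rw [hβ0, hp, sub_self, norm_zero] at hse'
      linarith
    · rintro rfl
      linarith
  choose! s hs1 hs2 using hs
  refine ⟨r₀ / 2, by positivity, fun p => φ p.2 (s p), ?_, ?_, ?_⟩
  · intro z hz
    rw [mem_sphere_iff_norm] at hz
    exact (hbK z (by linarith)).1
  · intro p hp
    refine ⟨?_, hs2 p hp, ?_⟩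
    · have h1 := hs1 p hp
      have h2 := hε2 p
      obtain ⟨e, _ | _⟩ := p
      · constructor <;> simp only [hφ, cond_false] <;> linarith [h1.1, h1.2]
      · constructor <;> simp only [hφ, cond_true] <;> linarith [h1.1, h1.2]
    · have := hpos p (s p) (hs1 p hp)
      rw [hβd, map_mul, Complex.conj_ofReal, mul_left_comm, Complex.re_ofReal_mul, hβ0, hp] at this
      exact this
  · intro z hz hzr
    have hzK := (hbK z (by linarith)).2
    have hzv : z ≠ v := by
      rintro rfl
      rw [sub_self, norm_zero] at hzr
      linarith
    rcases hz with hz | hz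
    · exact absurd (Or.inl (Finset.mem_coe.2 (Finset.mem_erase.2 ⟨hzv, hz⟩))) hzK
    · obtain ⟨e, t, ht, rfl⟩ := mem_iUnion.1 hz
      have htA : t ∈ A e := by
        by_contra hc
        exact hzK (Or.inr (mem_iUnion.2 ⟨e, t, ⟨ht, hc⟩, rfl⟩))
      obtain ⟨b, hbv, hbt⟩ := htA
      refine ⟨(e, b), hbv, ?_⟩
      have h1 : φ b t = s (e, b) := by
        refine (hmono (e, b)).injOn ⟨?_, hbt.le⟩
          ⟨(hs1 _ hbv).1.le, (hs1 _ hbv).2.le⟩ ?_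
        · cases b <;> simp [hφ, ht.1, ht.2]
        · have h2 := hs2 (e, b) hbv
          simp only [hβ, hφφ]
          have h3 : φ b 0 = cond b 1 0 := by cases b <;> simp [hφ]
          rw [h3, show Γ.arc e (cond b 1 0) = v from hbv, hzr]
          exact h2.symm
      change Γ.arc e (φ b (s (e, b))) = Γ.arc e t
      rw [← h1, hφφ]

/-- The face `F` lies on the left of the edge `e`, directed away from its endpoint `b`. -/
def OutgoingLeft (e : Γ.Edge) (b : Bool) (F : Γ.Face) : Prop :=
  cond b (Γ.RightOf e F) (Γ.LeftOf e F)

theorem OutgoingLeft.unique {e : Γ.Edge} {b : Bool} {F G : Γ.Face} (hF : OutgoingLeft e b F)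
    (hG : OutgoingLeft e b G) : F = G := by
  cases b
  · exact LeftOf.unique hF hG
  · exact RightOf.unique hF hG

theorem exists_outgoingLeft (e : Γ.Edge) (b : Bool) : ∃ F, OutgoingLeft e b F := by
  cases b
  · exact exists_leftOf e
  · exact exists_rightOf e

theorem OutgoingLeft.eventually {e : Γ.Edge} {b : Bool} {F G : Γ.Face} {t x : ℝ} {z : ℝ → ℂ}
    {z' : ℂ} (hF : OutgoingLeft e b F) (hG : OutgoingLeft e (!b) G) (ht : t ∈ Ioo (0 : ℝ) 1)
    (hz : HasDerivAt z z' x) (hx : z x = Γ.arc e t)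
    (hpos : 0 < (cond b (-1) 1) * (z' / deriv (Γ.arc e) t).im) :
    (∀ᶠ u in 𝓝[>] x, z u ∈ F.1) ∧ ∀ᶠ u in 𝓝[<] x, z u ∈ G.1 := by
  cases b
  · simp only [cond_false, one_mul] at hpos
    exact ⟨LeftOf.eventually_gt hF ht hz hx hpos, RightOf.eventually_lt hG ht hz hx hpos⟩
  · simp only [cond_true] at hpos
    exact ⟨RightOf.eventually_gt hF ht hz hx (by linarith),
      LeftOf.eventually_lt hG ht hz hx (by linarith)⟩

open Classical in
/-- Around an internal vertex, a face lies as often on the left of the edges directed away from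
the vertex as on their right. -/
theorem sum_outgoingLeft_eq_zero {v : ℂ} (hv : v ∈ Γ.internal) (F : Γ.Face) :
    ∑ p : Γ.Edge × Bool with Γ.endpoint p.1 p.2 = v,
      ((if OutgoingLeft p.1 p.2 F then 1 else 0) -
        (if OutgoingLeft p.1 (!p.2) F then 1 else 0) : ℤ) = 0 := by
  obtain ⟨r, hr, t, hrect, ht, hcar⟩ := exists_circle hv
  have hfin : (Metric.sphere v r ∩ Γ.carrier).Finite := by
    refine (finite_range fun p : Γ.Edge × Bool => Γ.arc p.1 (t p)).subset ?_
    rintro z ⟨hz1, hz2⟩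
    obtain ⟨p, -, hp⟩ := hcar z hz2 (mem_sphere_iff_norm.1 hz1)
    exact ⟨p, hp⟩
  have hinf : (Metric.sphere v r).Infinite := by
    refine (isPreconnected_sphere (by rw [Complex.rank_real_complex]; norm_num) v r
      ).infinite_of_nontrivial ⟨v + r, ?_, v - r, ?_, ?_⟩
    · simp [abs_of_pos hr]
    · simp [abs_of_pos hr]
    · intro h
      have h' := congrArg Complex.re h
      simp at h'
      linarith
  -- The circle is cut open at a point off the graph, so no crossing has argument `π` and the
  -- arguments of all crossings are interior to `[-π, π]`.
  obtain ⟨w₀, hw₀, hw₀'⟩ := (hinf.sdiff hfin).nonempty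
  have hwc : w₀ ∉ Γ.carrier := fun h => hw₀' ⟨hw₀, h⟩
  set w := w₀ - v with hw
  have hwr : ‖w‖ = r := mem_sphere_iff_norm.1 hw₀
  have hw0 : w ≠ 0 := by
    rw [← norm_pos_iff, hwr]
    exact hr
  set z : ℝ → ℂ := fun x => v - w * Complex.exp (x * Complex.I) with hz
  have hzs : ∀ x, z x ∈ Metric.sphere v r := by
    intro x
    rw [mem_sphere_iff_norm]
    simp [hz, Complex.norm_exp_ofReal_mul_I, hwr]
  have hzd : ∀ x, HasDerivAt z (Complex.I * (z x - v)) x := by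
    intro x
    have h1 : HasDerivAt (fun x : ℝ => (x : ℂ) * Complex.I) (1 * Complex.I) x :=
      (Complex.ofRealCLM.hasDerivAt (x := x)).mul_const _
    have h2 := (h1.cexp.const_mul w).const_sub v
    refine h2.congr_deriv ?_
    simp only [hz]
    ring
  have hzc : Continuous z := continuous_iff_continuousAt.2 fun x => (hzd x).continuousAt
  have hzpi : z Real.pi = w₀ ∧ z (-Real.pi) = w₀ := by
    constructor
    · simp [hz, Complex.exp_pi_mul_I, hw]
    · simp only [hz]
      push_cast
      rw [neg_mul, Complex.exp_neg, Complex.exp_pi_mul_I, hw]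
      norm_num
  set H : Finset (Γ.Edge × Bool) := Finset.univ.filter fun p => Γ.endpoint p.1 p.2 = v with hH
  have hHm : ∀ p ∈ H, Γ.endpoint p.1 p.2 = v := fun p hp => (Finset.mem_filter.1 hp).2
  set θ : Γ.Edge × Bool → ℝ := fun p => Complex.arg (-(Γ.arc p.1 (t p) - v) / w) with hθ
  have hzθ : ∀ p ∈ H, z (θ p) = Γ.arc p.1 (t p) := by
    intro p hp
    have h1 := Complex.norm_mul_exp_arg_mul_I (-(Γ.arc p.1 (t p) - v) / w)
    rw [norm_div, norm_neg, (ht p (hHm p hp)).2.1, hwr, div_self hr.ne', Complex.ofReal_one,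
      one_mul] at h1
    simp only [hz, hθ, h1]
    field_simp
    ring
  have hmemc : ∀ p ∈ H, Γ.arc p.1 (t p) ∈ Γ.carrier := fun p hp =>
    Or.inr (mem_iUnion.2 ⟨p.1, t p, Ioo_subset_Icc_self (ht p (hHm p hp)).1, rfl⟩)
  have hsign : ∀ p ∈ H, 0 < (cond p.2 (-1) 1) *
      (Complex.I * (z (θ p) - v) / deriv (Γ.arc p.1) (t p)).im := by
    intro p hp
    have h1 := (ht p (hHm p hp)).2.2
    have hd : deriv (Γ.arc p.1) (t p) ≠ 0 :=
      Γ.arc_regular _ _ (Ioo_subset_Icc_self (ht p (hHm p hp)).1)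
    have h2 : (Complex.I * (z (θ p) - v) / deriv (Γ.arc p.1) (t p)).im =
        ((Γ.arc p.1 (t p) - v) * conj (deriv (Γ.arc p.1) (t p))).re *
          (Complex.normSq (deriv (Γ.arc p.1) (t p)))⁻¹ := by
      rw [hzθ p hp, mul_div_assoc, Complex.I_mul_im, div_eq_mul_inv, Complex.inv_def, ← mul_assoc,
        Complex.re_mul_ofReal]
    rw [h2, ← mul_assoc]
    exact mul_pos h1 (inv_pos.2 (Complex.normSq_pos.2 hd))
  have hinj : InjOn θ H := by
    rintro ⟨e, b⟩ hp ⟨e', b'⟩ hp' h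
    have h1 := hzθ _ hp
    rw [h, hzθ _ hp'] at h1
    obtain ⟨h2, h3⟩ := eq_of_arc_eq (ht _ (hHm _ hp)).1
      (Ioo_subset_Icc_self (ht _ (hHm _ hp')).1) h1
    simp only at h2 h3
    subst h2
    -- One crossing point on both half-edges of the same edge would give the same real number both
    -- signs.
    have h4 := (ht _ (hHm _ hp)).2.2
    have h5 := (ht _ (hHm _ hp')).2.2
    rw [h3] at h5
    cases b <;> cases b' <;> simp at h4 h5 ⊢ <;> linarith
  -- The indicator of `F` along the circle returns to its initial value. Its jump at a half-edge,
  -- crossed counterclockwise, is the left indicator minus the right one.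
  set χ : ℝ → ℤ := fun x => if z x ∈ F.1 then 1 else 0 with hχ
  have hout : ∀ p ∈ H,
      (∀ᶠ x in 𝓝[>] (θ p), χ x = if OutgoingLeft p.1 p.2 F then 1 else 0) ∧
      ∀ᶠ x in 𝓝[<] (θ p), χ x = if OutgoingLeft p.1 (!p.2) F then 1 else 0 := by
    intro p hp
    obtain ⟨L, hL⟩ := exists_outgoingLeft p.1 p.2
    obtain ⟨R, hR⟩ := exists_outgoingLeft p.1 (!p.2)
    obtain ⟨h1, h2⟩ := hL.eventually hR (ht p (hHm p hp)).1 (hzd _) (hzθ p hp) (hsign p hp)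
    have key : ∀ {b : Bool} {G : Γ.Face}, OutgoingLeft p.1 b G → ∀ x, z x ∈ G.1 →
        χ x = if OutgoingLeft p.1 b F then 1 else 0 := by
      intro b G hG x hx
      have : z x ∈ F.1 ↔ OutgoingLeft p.1 b F :=
        ⟨fun h => Face.eq_of_mem h hx ▸ hG, fun h => h.unique hG ▸ hx⟩
      simp only [hχ, this]
    constructor
    · filter_upwards [h1] with x hx using key hL x hx
    · filter_upwards [h2] with x hx using key hR x hx
  have := sub_eq_sum_jumps H θ hinj χ _ _ (-Real.pi) Real.pi (by linarith [Real.pi_pos]) ?_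
    (fun p hp => (hout p hp).2) (fun p hp => (hout p hp).1) ?_
  · rw [← this]
    simp [hχ, hzpi]
  · intro p hp
    refine ⟨Complex.neg_pi_lt_arg _, lt_of_le_of_ne (Complex.arg_le_pi _) fun h => hwc ?_⟩
    rw [← hzpi.1, ← h]
    exact hzθ p hp ▸ hmemc p hp
  · intro x hxI hx
    have hxc : z x ∈ Γ.compl := by
      refine ⟨hrect (hzs x), fun h => ?_⟩
      obtain ⟨p, hp, hpx⟩ := hcar _ h (mem_sphere_iff_norm.1 (hzs x))
      have hpH : p ∈ H := Finset.mem_filter.2 ⟨Finset.mem_univ _, hp⟩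
      have hex : Complex.exp (θ p * Complex.I) = Complex.exp (x * Complex.I) := by
        have h1 := (hzθ p hpH).trans hpx
        simp only [hz] at h1
        exact mul_left_cancel₀ hw0 (sub_right_injective h1)
      have hx' : x ≠ -Real.pi := by
        rintro rfl
        exact hwc (hzpi.2 ▸ h)
      have h2 := Complex.exp_inj_of_neg_pi_lt_of_le_pi (by simpa using Complex.neg_pi_lt_arg _)
        (by simpa using Complex.arg_le_pi _) (by simpa using lt_of_le_of_ne hxI.1 hx'.symm)
        (by simpa using hxI.2) hex
      exact hx p hpH (by simpa using h2)
    obtain ⟨G, hG⟩ := exists_face_superset isPreconnected_singleton (singleton_nonempty (z x))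
      (singleton_subset_iff.2 hxc)
    filter_upwards [hzc.continuousAt.eventually ((G.isOpen Γ).mem_nhds (singleton_subset_iff.1 hG))]
      with y hy
    have : z y ∈ F.1 ↔ z x ∈ F.1 :=
      ⟨fun h => Face.eq_of_mem hy h ▸ singleton_subset_iff.1 hG,
        fun h => Face.eq_of_mem (singleton_subset_iff.1 hG) h ▸ hy⟩
    simp only [hχ, this]

/-! ### The product of all face weights is a Casimir function -/

variable (Γ) in
open Classical in
/-- Half the sign of the colour of a vertex, and `0` for boundary vertices. -/
def colorHeight (v : ℂ) : ℚ :=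
  (if v ∈ Γ.white then 1 / 2 else 0) - (if v ∈ Γ.black then 1 / 2 else 0)

-- The signed weight of the dual arrow is a difference of vertex heights, half-arrows included,
-- since boundary vertices have height 0. The row sum is thereby a sum over edges with a telescoping
-- shape.
open Classical in
theorem sum_arrows_sub (F : Γ.Face) : ∑ G, Γ.q F G =
    ∑ e, (Γ.colorHeight (Γ.endpoint e true) - Γ.colorHeight (Γ.endpoint e false)) *
      ((if Γ.LeftOf e F then 1 else 0) - (if Γ.RightOf e F then 1 else 0)) := by
  simp only [q, arrows, ← Finset.sum_sub_distrib]
  rw [Finset.sum_comm]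
  refine Finset.sum_congr rfl fun e _ => ?_
  obtain ⟨L, hL⟩ := exists_leftOf e
  obtain ⟨R, hR⟩ := exists_rightOf e
  have hLi : ∀ G, Γ.LeftOf e G ↔ G = L := fun G => ⟨fun h => h.unique hL, fun h => h ▸ hL⟩
  have hRi : ∀ G, Γ.RightOf e G ↔ G = R := fun G => ⟨fun h => h.unique hR, fun h => h ▸ hR⟩
  set w : ℚ := if ∀ b, Γ.endpoint e b ∈ Γ.internal then 1 else 1 / 2 with hw
  set P : ℚ := if Γ.BlackToWhite (Γ.endpoint e false) (Γ.endpoint e true) then w else 0 with hP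
  set M : ℚ := if Γ.BlackToWhite (Γ.endpoint e true) (Γ.endpoint e false) then w else 0 with hM
  have hPM : P - M = Γ.colorHeight (Γ.endpoint e true) - Γ.colorHeight (Γ.endpoint e false) := by
    have hd : ∀ b, Γ.endpoint e b ∈ Γ.black → Γ.endpoint e b ∉ Γ.white := fun b h h' =>
      Finset.disjoint_left.1 Γ.disjoint_colors h h'
    have h0 := hd false
    have h1 := hd true
    simp only [hP, hM, hw, BlackToWhite, colorHeight, Bool.forall_bool, internal, Finset.mem_union]
    by_cases a1 : Γ.endpoint e false ∈ Γ.black <;> by_cases a2 : Γ.endpoint e false ∈ Γ.white <;>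
      by_cases a3 : Γ.endpoint e true ∈ Γ.black <;> by_cases a4 : Γ.endpoint e true ∈ Γ.white <;>
      first
      | exact absurd a2 (h0 a1)
      | exact absurd a4 (h1 a3)
      | (simp [a1, a2, a3, a4]; try norm_num)
  have harr : ∀ A B, (if Γ.Arrow e A B then w else 0) =
      P * ((if A = L then 1 else 0) * (if B = R then 1 else 0)) +
      M * ((if A = R then 1 else 0) * (if B = L then 1 else 0)) := by
    intro A B
    simp only [Arrow, hLi, hRi, hP, hM]
    by_cases hb : Γ.BlackToWhite (Γ.endpoint e false) (Γ.endpoint e true)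
    · simp only [hb, hb.asymm, true_and, false_and, or_false, if_true, if_false, zero_mul, add_zero]
      split_ifs <;> simp_all
    · simp only [hb, false_and, false_or, if_false, zero_mul, zero_add, ite_mul]
      split_ifs <;> simp_all
  simp only [harr, hLi, hRi, ← hPM]
  rw [Finset.sum_sub_distrib, Finset.sum_add_distrib, Finset.sum_add_distrib]
  simp only [← Finset.mul_sum, ← Finset.sum_mul, Finset.sum_ite_eq', Finset.mem_univ, if_true]
  ring

-- Summation by parts: regrouped by half-edges, the sum has the constant factor `colorHeight v` at
-- each internal vertex `v`, times an expression that vanishes by going once around `v`. Boundary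
-- vertices contribute nothing.
open Classical in
theorem sum_q_eq_zero (F : Γ.Face) : ∑ G, Γ.q F G = 0 := by
  set D : Γ.Edge × Bool → ℤ := fun p => (if OutgoingLeft p.1 p.2 F then 1 else 0) -
    (if OutgoingLeft p.1 (!p.2) F then 1 else 0) with hD
  have h1 : ∑ G, Γ.q F G = -∑ p : Γ.Edge × Bool, Γ.colorHeight (Γ.endpoint p.1 p.2) * D p := by
    rw [sum_arrows_sub, Fintype.sum_prod_type, ← Finset.sum_neg_distrib]
    refine Finset.sum_congr rfl fun e _ => ?_
    simp only [Fintype.sum_bool, hD, OutgoingLeft, cond_true, cond_false, Bool.not_true,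
      Bool.not_false]
    by_cases hl : Γ.LeftOf e F <;> by_cases hr : Γ.RightOf e F <;> simp [hl, hr] <;> ring
  have h2 : ∀ p : Γ.Edge × Bool, Γ.colorHeight (Γ.endpoint p.1 p.2) * D p =
      ∑ v ∈ Γ.internal, if Γ.endpoint p.1 p.2 = v then Γ.colorHeight v * D p else 0 := by
    intro p
    rw [Finset.sum_ite_eq]
    split_ifs with h
    · rfl
    · simp only [internal, Finset.mem_union, not_or] at h
      simp [colorHeight, h.1, h.2]
  rw [h1, neg_eq_zero, Finset.sum_congr rfl fun p _ => h2 p, Finset.sum_comm]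
  refine Finset.sum_eq_zero fun v hv => ?_
  have h3 := sum_outgoingLeft_eq_zero hv F
  rw [← Finset.sum_filter, ← Finset.mul_sum, ← Int.cast_sum]
  simp only [hD]
  rw [h3, Int.cast_zero, mul_zero]

/-! ### The involution in coordinates -/

theorem IsMoveSymmetric.arrowCount_mirror_left (hΓ : Γ.IsMoveSymmetric) {k : Γ.Face}
    (hk : Γ.IsMidSquare k) (i : Γ.Face) : arrowCount (hΓ.mirror i) k = arrowCount k i := by
  conv_lhs => rw [← hΓ.mirror_of_isMidSquare hk]
  exact hΓ.arrowCount_mirror (Or.inl hk)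

theorem IsMoveSymmetric.arrowCount_mirror_right (hΓ : Γ.IsMoveSymmetric) {k : Γ.Face}
    (hk : Γ.IsMidSquare k) (i : Γ.Face) : arrowCount k (hΓ.mirror i) = arrowCount i k := by
  conv_lhs => rw [← hΓ.mirror_of_isMidSquare hk]
  exact hΓ.arrowCount_mirror (Or.inr hk)

theorem arrowCount_squares (hΓ : Γ.IsMoveSymmetric) {F G : Γ.Face} (hF : Γ.IsMidSquare F)
    (hG : Γ.IsMidSquare G) : arrowCount F G = 0 := by
  have : IsEmpty {e // Γ.Arrow e F G} := ⟨fun e => not_side_both_squares hΓ hF hG e.2⟩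
  exact Nat.card_of_isEmpty

theorem q_square_right (hΓ : Γ.IsMoveSymmetric) {k : Γ.Face} (hk : Γ.IsMidSquare k)
    (i : Γ.Face) : Γ.q i k = arrowCount i k - arrowCount k i := by
  rw [q, arrows_eq_arrowCount (Or.inr (hΓ.movable k hk)),
    arrows_eq_arrowCount (Or.inl (hΓ.movable k hk))]

theorem q_add_q_mirror_square (hΓ : Γ.IsMoveSymmetric) {k : Γ.Face} (hk : Γ.IsMidSquare k)
    (i : Γ.Face) : Γ.q i k + Γ.q (hΓ.mirror i) k = 0 := by
  rw [q_square_right hΓ hk, q_square_right hΓ hk, hΓ.arrowCount_mirror_left hk,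
    hΓ.arrowCount_mirror_right hk]
  ring

open Classical in
theorem prod_ite_arrow (F G : Γ.Face) (x : ℂ) :
    ∏ e, (if Γ.Arrow e F G then x else 1) = x ^ arrowCount F G := by
  rw [Finset.prod_ite, Finset.prod_const, Finset.prod_const_one, mul_one, arrowCount,
    Nat.card_eq_fintype_card, Fintype.card_subtype]

theorem IsMoveSymmetric.sigma_square (hΓ : Γ.IsMoveSymmetric) {k : Γ.Face}
    (hk : Γ.IsMidSquare k) (y : Γ.Face → ℂ) : hΓ.sigma y k = (y k)⁻¹ := by
  rw [sigma, hΓ.mirror_of_isMidSquare hk, squareMoves, if_pos hk]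

-- The weight is read off at the mirror face, and the reflection reverses its arrows at the squares;
-- hence the exponents are those of `i` with the directions exchanged.
open Classical in
theorem IsMoveSymmetric.sigma_not_square (hΓ : Γ.IsMoveSymmetric) {i : Γ.Face}
    (hi : ¬ Γ.IsMidSquare i) (y : Γ.Face → ℂ) : hΓ.sigma y i = y (hΓ.mirror i) *
      ∏ k with Γ.IsMidSquare k,
        ((1 + y k) ^ arrowCount k i * ((1 + (y k)⁻¹)⁻¹) ^ arrowCount i k) := by
  rw [sigma, squareMoves, if_neg (by rwa [hΓ.isMidSquare_mirror])]
  congr 1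
  refine Finset.prod_congr rfl fun k hk => ?_
  have hk := (Finset.mem_filter.1 hk).2
  rw [Finset.prod_mul_distrib, prod_ite_arrow, prod_ite_arrow, hΓ.arrowCount_mirror_left hk,
    hΓ.arrowCount_mirror_right hk]

theorem one_add_inv_ne_zero {x : ℂ} (h0 : x ≠ 0) (h1 : 1 + x ≠ 0) : 1 + x⁻¹ ≠ 0 := by
  intro h
  apply h1
  have : x * (1 + x⁻¹) = 1 + x := by
    rw [mul_add, mul_inv_cancel₀ h0]
    ring
  rw [← this, h, mul_zero]

/-- The second application sees inverted square weights and exchanged arrow directions, so its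
factors are the inverses of the first ones. -/
theorem IsMoveSymmetric.sigma_sigma (hΓ : Γ.IsMoveSymmetric) {i : Γ.Face}
    (hi : ¬ Γ.IsMidSquare i) {y : Γ.Face → ℂ} (hy : y ∈ Γ.domain) :
    hΓ.sigma (hΓ.sigma y) i = y i := by
  classical
  rw [hΓ.sigma_not_square hi, hΓ.sigma_not_square (by rwa [hΓ.isMidSquare_mirror]),
    hΓ.mirror_mirror, mul_assoc, ← Finset.prod_mul_distrib]
  refine (congrArg _ (Finset.prod_eq_one fun k hk => ?_)).trans (mul_one _)
  have hk := (Finset.mem_filter.1 hk).2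
  rw [hΓ.sigma_square hk, hΓ.arrowCount_mirror_left hk, hΓ.arrowCount_mirror_right hk, inv_inv]
  have h1 := hy.2 k hk
  have h2 := one_add_inv_ne_zero (hy.1 k) h1
  generalize 1 + y k = p at h1 ⊢
  generalize 1 + (y k)⁻¹ = q at h2 ⊢
  rw [inv_pow, inv_pow]
  field_simp

theorem isOpen_domain : IsOpen Γ.domain := by
  have : Γ.domain = (⋂ i, {y : Γ.Face → ℂ | y i ≠ 0}) ∩
      ⋂ k, ⋂ (_ : Γ.IsMidSquare k), {y : Γ.Face → ℂ | 1 + y k ≠ 0} := by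
    ext y
    simp [domain]
  rw [this]
  refine (isOpen_iInter_of_finite fun i => ?_).inter
    (isOpen_iInter_of_finite fun k => isOpen_iInter_of_finite fun _ => ?_)
  · exact isOpen_ne_fun (continuous_apply i) continuous_const
  · exact isOpen_ne_fun (continuous_const.add (continuous_apply k)) continuous_const

theorem differentiableOn_prod {E ι : Type*} [NormedAddCommGroup E] [NormedSpace ℂ E]
    {s : Finset ι} {f : ι → E → ℂ} {S : Set E} (hf : ∀ i ∈ s, DifferentiableOn ℂ (f i) S) :
    DifferentiableOn ℂ (fun x => ∏ i ∈ s, f i x) S := by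
  classical
  induction s using Finset.induction_on with
  | empty => simp
  | insert j s hj ih =>
    simp only [Finset.prod_insert hj]
    exact (hf j (Finset.mem_insert_self _ _)).mul
      (ih fun i hi => hf i (Finset.mem_insert_of_mem hi))

theorem IsMoveSymmetric.differentiableOn_sigma (hΓ : Γ.IsMoveSymmetric) {i : Γ.Face}
    (hi : ¬ Γ.IsMidSquare i) : DifferentiableOn ℂ (fun y => hΓ.sigma y i) Γ.domain := by
  classical
  simp only [hΓ.sigma_not_square hi]
  have hc : ∀ j : Γ.Face, DifferentiableOn ℂ (fun y : Γ.Face → ℂ => y j) Γ.domain :=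
    fun j => (differentiable_apply j).differentiableOn
  refine (hc _).mul (differentiableOn_prod fun k hk => ?_)
  have hk := (Finset.mem_filter.1 hk).2
  refine (((hc k).const_add 1).pow _).mul (DifferentiableOn.pow (DifferentiableOn.inv
    (DifferentiableOn.const_add 1 ((hc k).inv fun y hy => hy.1 k)) fun y hy => ?_) _)
  exact one_add_inv_ne_zero (hy.1 k) (hy.2 k hk)

/-! ### Move-symmetric weightings -/

section

variable (hΓ : Γ.IsMoveSymmetric)

theorem IsMoveSymmetric.eq_one_of_square {y : Γ.Face → ℂ} (hy : y ∈ hΓ.msWeightings) {k : Γ.Face}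
    (hk : Γ.IsMidSquare k) : y k = 1 := by
  have h1 := congrFun hy.2.2 k
  rw [hΓ.sigma_square hk] at h1
  have h2 : (y k - 1) * (1 + y k) = 0 := by
    have := mul_inv_cancel₀ (hy.2.1.1 k)
    rw [h1] at this
    linear_combination this
  exact sub_eq_zero.1 ((mul_eq_zero.1 h2).resolve_right (hy.2.1.2 k hk))

open Classical in
/-- The constant ratio `y_i / y_{i'}` for move-symmetric weightings `y`. -/
def ratio (i : Γ.Face) : ℝ :=
  ∏ k with Γ.IsMidSquare k, ((2 : ℝ) ^ arrowCount k i * (2⁻¹) ^ arrowCount i k)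

theorem ratio_pos (i : Γ.Face) : 0 < ratio i := Finset.prod_pos fun _ _ => by positivity

theorem IsMoveSymmetric.eq_ratio_mul {y : Γ.Face → ℂ} (hy : y ∈ hΓ.msWeightings) {i : Γ.Face}
    (hi : ¬ Γ.IsMidSquare i) : y i = ratio i * y (hΓ.mirror i) := by
  classical
  conv_lhs => rw [← hy.2.2, hΓ.sigma_not_square hi, mul_comm]
  congr 1
  rw [ratio]
  push_cast
  refine Finset.prod_congr rfl fun k hk => ?_
  rw [hΓ.eq_one_of_square hy (Finset.mem_filter.1 hk).2]
  norm_num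

/-- The mirror appears because `ratio i` is the factor from `y_{i'}` to `y_i`, while `c_i` goes the
other way. -/
theorem IsMoveSymmetric.isMirrorRatio_ratio :
    hΓ.IsMirrorRatio fun i => ratio (hΓ.mirror i) := by
  intro i hi
  refine ⟨ratio_pos _, fun y hy => ?_⟩
  have := hΓ.eq_ratio_mul hy (i := hΓ.mirror i)
    (by rw [hΓ.isMidSquare_mirror]; exact not_isMidSquare_of_isUpper hi)
  rwa [hΓ.mirror_mirror] at this

/-- The average over the involution is invariant, and on fixed points both of its terms agree. -/
theorem IsMoveSymmetric.exists_isInvariantExtension (c : Γ.Face → ℝ) {i : Γ.Face}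
    (hi : ¬ Γ.IsMidSquare i) : ∃ F, hΓ.IsInvariantExtension (hΓ.geomMean c i) F := by
  refine ⟨fun y => (Real.sqrt (c i) / 2 : ℂ) * (y i + hΓ.sigma y i), ?_, ?_, ?_⟩
  · exact ((differentiable_apply i).differentiableOn.add
      (hΓ.differentiableOn_sigma hi)).const_mul _
  · intro y _ hy
    simp only [hΓ.sigma_sigma hi hy, add_comm]
  · intro y
    simp only [y.2.2.2, geomMean]
    ring

/-! ### The differentials of invariant extensions -/

/-- The curve through the face weighting `y` with logarithmic velocity `v`. -/
def expCurve (y v : Γ.Face → ℂ) (t : ℂ) : Γ.Face → ℂ := fun a => y a * Complex.exp (t * v a)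

theorem expCurve_zero (y v : Γ.Face → ℂ) : expCurve y v 0 = y := by
  funext a
  simp [expCurve]

theorem hasDerivAt_exp_mul (v : ℂ) : HasDerivAt (fun t : ℂ => Complex.exp (t * v)) v 0 := by
  have := ((hasDerivAt_id (0 : ℂ)).mul_const v).cexp
  simpa using this

theorem hasDerivAt_expCurve (y v : Γ.Face → ℂ) : HasDerivAt (expCurve y v) (y * v) 0 :=
  hasDerivAt_pi.2 fun a => (hasDerivAt_exp_mul (v a)).const_mul (y a)

theorem expCurve_mem_weightings {y v : Γ.Face → ℂ} (hy : y ∈ Γ.weightings) (hv : ∑ a, v a = 0)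
    (t : ℂ) : expCurve y v t ∈ Γ.weightings := by
  refine ⟨fun a => mul_ne_zero (hy.1 a) (Complex.exp_ne_zero _), ?_⟩
  simp only [expCurve]
  rw [Finset.prod_mul_distrib, hy.2, ← Complex.exp_sum, ← Finset.mul_sum, hv]
  simp

open Classical in
/-- The differential of the involution at a fixed point, in logarithmic coordinates. -/
def IsMoveSymmetric.dsigma (v : Γ.Face → ℂ) (i : Γ.Face) : ℂ :=
  v (hΓ.mirror i) + 1 / 2 * ∑ k with Γ.IsMidSquare k,
    ((arrowCount k i : ℂ) + arrowCount i k) * v k - if Γ.IsMidSquare i then 2 * v i else 0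

/-- With derivatives written as value times logarithmic derivative, products become sums. -/
theorem hasDerivAt_mul_log {f g : ℂ → ℂ} {a b : ℂ} (hf : HasDerivAt f (f 0 * a) 0)
    (hg : HasDerivAt g (g 0 * b) 0) :
    HasDerivAt (fun t => f t * g t) (f 0 * g 0 * (a + b)) 0 :=
  (hf.mul hg).congr_deriv (by ring)

theorem hasDerivAt_pow_log {f : ℂ → ℂ} {a : ℂ} (hf : HasDerivAt f (f 0 * a) 0) (m : ℕ) :
    HasDerivAt (fun t => f t ^ m) (f 0 ^ m * (m * a)) 0 := by
  induction m with
  | zero => simpa using hasDerivAt_const (0 : ℂ) (1 : ℂ)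
  | succ m ih =>
    simp only [pow_succ]
    refine (hasDerivAt_mul_log ih hf).congr_deriv ?_
    push_cast
    ring

theorem hasDerivAt_prod_log {ι : Type*} (s : Finset ι) {f : ι → ℂ → ℂ} {a : ι → ℂ}
    (hf : ∀ i ∈ s, HasDerivAt (f i) (f i 0 * a i) 0) :
    HasDerivAt (fun t => ∏ i ∈ s, f i t) ((∏ i ∈ s, f i 0) * ∑ i ∈ s, a i) 0 := by
  classical
  induction s using Finset.induction_on with
  | empty => simpa using hasDerivAt_const (0 : ℂ) (1 : ℂ)
  | insert j s hj ih =>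
    simp only [Finset.prod_insert hj, Finset.sum_insert hj]
    exact hasDerivAt_mul_log (hf j (Finset.mem_insert_self _ _))
      (ih fun i hi => hf i (Finset.mem_insert_of_mem hi))

/-- At `y_k = 1` both `1 + y_k` and `(1 + y_k⁻¹)⁻¹` have logarithmic derivative `v_k / 2`, so only
the total number of arrows between `i` and `k` enters, not their directions. -/
theorem IsMoveSymmetric.hasDerivAt_sigma_expCurve {y : Γ.Face → ℂ} (hy : y ∈ hΓ.msWeightings)
    (v : Γ.Face → ℂ) :
    HasDerivAt (fun t => hΓ.sigma (expCurve y v t)) (y * hΓ.dsigma v) 0 := by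
  classical
  refine hasDerivAt_pi.2 fun i => ?_
  rw [Pi.mul_apply]
  by_cases hi : Γ.IsMidSquare i
  · simp only [hΓ.sigma_square hi, expCurve, hΓ.eq_one_of_square hy hi, one_mul]
    have h0 : ∑ k with Γ.IsMidSquare k, ((arrowCount k i : ℂ) + arrowCount i k) * v k = 0 := by
      refine Finset.sum_eq_zero fun k hk => ?_
      have hk := (Finset.mem_filter.1 hk).2
      simp [arrowCount_squares hΓ hk hi, arrowCount_squares hΓ hi hk]
    rw [dsigma, h0, if_pos hi, hΓ.mirror_of_isMidSquare hi]
    refine ((hasDerivAt_exp_mul (v i)).inv (Complex.exp_ne_zero _)).congr_deriv ?_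
    simp
    ring
  · have hfix := congrFun hy.2.2 i
    simp only [hΓ.sigma_not_square hi] at hfix ⊢
    have h1 : HasDerivAt (fun t => expCurve y v t (hΓ.mirror i))
        (expCurve y v 0 (hΓ.mirror i) * v (hΓ.mirror i)) 0 := by
      rw [expCurve_zero]
      exact (hasDerivAt_exp_mul (v (hΓ.mirror i))).const_mul (y (hΓ.mirror i))
    have h2 : ∀ k ∈ Finset.univ.filter Γ.IsMidSquare, HasDerivAt
        (fun t => (1 + expCurve y v t k) ^ arrowCount k i *
          ((1 + (expCurve y v t k)⁻¹)⁻¹) ^ arrowCount i k)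
        ((1 + expCurve y v 0 k) ^ arrowCount k i *
          ((1 + (expCurve y v 0 k)⁻¹)⁻¹) ^ arrowCount i k *
            (arrowCount k i * (v k / 2) + arrowCount i k * (v k / 2))) 0 := by
      intro k hk
      have hk := (Finset.mem_filter.1 hk).2
      have hexp : ∀ t, expCurve y v t k = Complex.exp (t * v k) := fun t => by
        rw [expCurve, hΓ.eq_one_of_square hy hk, one_mul]
      simp only [hexp]
      refine hasDerivAt_mul_log (hasDerivAt_pow_log ?_ _) (hasDerivAt_pow_log ?_ _)
      · refine ((hasDerivAt_exp_mul (v k)).const_add 1).congr_deriv ?_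
        norm_num
        ring
      · have h3 := ((hasDerivAt_exp_mul (v k)).inv (Complex.exp_ne_zero _)).const_add 1
        refine (h3.inv ?_).congr_deriv ?_
        · norm_num
        · norm_num
          ring
    refine (hasDerivAt_mul_log h1 (hasDerivAt_prod_log _ h2)).congr_deriv ?_
    rw [expCurve_zero, hfix, dsigma, if_neg hi, sub_zero, Finset.mul_sum]
    congr 2
    exact Finset.sum_congr rfl fun k _ => by ring

/-- This is the infinitesimal form of `σ` preserving the product of the weights: each square loses
`2 v_k` by inversion, and its four edges pass `v_k / 2` each to the neighbouring faces. -/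
theorem IsMoveSymmetric.sum_dsigma (v : Γ.Face → ℂ) : ∑ i, hΓ.dsigma v i = ∑ i, v i := by
  classical
  simp only [dsigma]
  have h1 : ∑ i, v (hΓ.mirror i) = ∑ i, v i :=
    Equiv.sum_comp (Function.Involutive.toPerm hΓ.mirror hΓ.mirror_mirror) v
  rw [Finset.sum_sub_distrib, Finset.sum_add_distrib, h1, ← Finset.mul_sum, Finset.sum_comm,
    ← Finset.sum_filter]
  have h2 : ∀ k ∈ Finset.univ.filter Γ.IsMidSquare,
      ∑ i, ((arrowCount k i : ℂ) + arrowCount i k) * v k = 4 * v k := by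
    intro k hk
    have h := sum_arrowCount_square hΓ (Finset.mem_filter.1 hk).2
    rw [← Finset.sum_mul]
    congr 1
    simp only [add_comm (arrowCount k _ : ℂ)]
    exact_mod_cast h
  rw [Finset.sum_congr rfl h2, ← Finset.mul_sum, ← Finset.mul_sum]
  ring

theorem IsMoveSymmetric.add_dsigma_square {k : Γ.Face} (hk : Γ.IsMidSquare k)
    (v : Γ.Face → ℂ) : v k + hΓ.dsigma v k = 0 := by
  classical
  have h0 : ∑ l with Γ.IsMidSquare l, ((arrowCount l k : ℂ) + arrowCount k l) * v l = 0 := by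
    refine Finset.sum_eq_zero fun l hl => ?_
    have hl := (Finset.mem_filter.1 hl).2
    simp [arrowCount_squares hΓ hk hl, arrowCount_squares hΓ hl hk]
  rw [dsigma, h0, if_pos hk, hΓ.mirror_of_isMidSquare hk]
  ring

theorem IsMoveSymmetric.add_dsigma_mirror {i : Γ.Face} (hi : ¬ Γ.IsMidSquare i)
    (v : Γ.Face → ℂ) :
    v (hΓ.mirror i) + hΓ.dsigma v (hΓ.mirror i) = v i + hΓ.dsigma v i := by
  classical
  rw [dsigma, dsigma, if_neg hi, if_neg (by rwa [hΓ.isMidSquare_mirror]), hΓ.mirror_mirror]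
  have : ∀ k ∈ Finset.univ.filter Γ.IsMidSquare,
      ((arrowCount k (hΓ.mirror i) : ℂ) + arrowCount (hΓ.mirror i) k) * v k =
        ((arrowCount k i : ℂ) + arrowCount i k) * v k := by
    intro k hk
    have hk := (Finset.mem_filter.1 hk).2
    rw [hΓ.arrowCount_mirror_left hk, hΓ.arrowCount_mirror_right hk, add_comm (arrowCount i k : ℂ)]
  rw [Finset.sum_congr rfl this]
  ring

/-- The fixed vectors of the differential of the involution are tangent to its fixed point set. -/
theorem IsMoveSymmetric.expCurve_mem_msWeightings {y w : Γ.Face → ℂ} (hy : y ∈ hΓ.msWeightings)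
    (hsum : ∑ a, w a = 0) (hsq : ∀ k, Γ.IsMidSquare k → w k = 0)
    (hm : ∀ i, ¬ Γ.IsMidSquare i → w (hΓ.mirror i) = w i) (t : ℂ) :
    expCurve y w t ∈ hΓ.msWeightings := by
  classical
  have hk : ∀ k, Γ.IsMidSquare k → expCurve y w t k = y k := fun k hk => by
    simp [expCurve, hsq k hk]
  have hw := expCurve_mem_weightings hy.1 hsum t
  refine ⟨hw, ⟨hw.1, fun k hk' => by rw [hk k hk']; exact hy.2.1.2 k hk'⟩, ?_⟩
  funext i
  by_cases hi : Γ.IsMidSquare i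
  · rw [hΓ.sigma_square hi, hk i hi, hΓ.eq_one_of_square hy hi, inv_one]
  · have hfix := congrFun hy.2.2 i
    rw [hΓ.sigma_not_square hi] at hfix ⊢
    rw [Finset.prod_congr rfl fun k hk' => by rw [hk k (Finset.mem_filter.1 hk').2]]
    simp only [expCurve]
    rw [hm i hi, mul_right_comm, hfix]

/-- Since `dF` takes the same value on `v` and on `dσ v`, it is half its value on their sum, which
is tangent to the fixed point set, where `F` is prescribed. -/
theorem IsMoveSymmetric.fderiv_invariantExtension {c : Γ.Face → ℝ} {i : Γ.Face}
    {F : (Γ.Face → ℂ) → ℂ} (hF : hΓ.IsInvariantExtension (hΓ.geomMean c i) F) {y : Γ.Face → ℂ}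
    (hy : y ∈ hΓ.msWeightings) {v : Γ.Face → ℂ} (hv : ∑ a, v a = 0) :
    fderiv ℂ F y (y * v) = 1 / 2 * (Real.sqrt (c i) * y i) * (v i + hΓ.dsigma v i) := by
  have hFd : HasFDerivAt F (fderiv ℂ F y) y :=
    (hF.differentiableOn.differentiableAt (isOpen_domain.mem_nhds hy.2.1)).hasFDerivAt
  have hcomp : ∀ {Y : ℂ → Γ.Face → ℂ} {Y' : Γ.Face → ℂ}, Y 0 = y → HasDerivAt Y Y' 0 →
      HasDerivAt (fun t => F (Y t)) (fderiv ℂ F y Y') 0 := by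
    intro Y Y' h0 hY
    exact HasFDerivAt.comp_hasDerivAt (0 : ℂ) (by rwa [h0]) hY
  have h1 := hcomp (expCurve_zero y v) (hasDerivAt_expCurve y v)
  have h2 := hcomp (by rw [expCurve_zero]; exact hy.2.2) (hΓ.hasDerivAt_sigma_expCurve hy v)
  have hev : (fun t => F (hΓ.sigma (expCurve y v t))) =ᶠ[𝓝 0] fun t => F (expCurve y v t) := by
    have hd : ∀ᶠ t in 𝓝 (0 : ℂ), expCurve y v t ∈ Γ.domain :=
      (hasDerivAt_expCurve y v).continuousAt.eventually
        (by rw [expCurve_zero]; exact isOpen_domain.mem_nhds hy.2.1)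
    filter_upwards [hd] with t ht
    exact hF.invariant _ (expCurve_mem_weightings hy.1 hv t) ht
  have h3 : fderiv ℂ F y (y * hΓ.dsigma v) = fderiv ℂ F y (y * v) :=
    (h2.congr_of_eventuallyEq hev.symm).unique h1
  set w := v + hΓ.dsigma v with hw
  have hsum : ∑ a, w a = 0 := by
    simp only [hw, Pi.add_apply]
    rw [Finset.sum_add_distrib, hΓ.sum_dsigma, hv, add_zero]
  have hms := hΓ.expCurve_mem_msWeightings hy hsum (fun k hk => hΓ.add_dsigma_square hk v)
    (fun j hj => hΓ.add_dsigma_mirror hj v)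
  -- The curve with velocity `w` stays in the fixed point set, so `F` along it is the explicit
  -- function `√c_i y_i`.
  have h4 := hcomp (expCurve_zero y w) (hasDerivAt_expCurve y w)
  have h5 : (fun t => F (expCurve y w t)) =
      fun t => (Real.sqrt (c i) : ℂ) * (y i * Complex.exp (t * w i)) := by
    funext t
    exact hF.extends_f ⟨_, hms t⟩
  rw [h5] at h4
  have h6 := h4.unique (((hasDerivAt_exp_mul (w i)).const_mul (y i)).const_mul _)
  rw [hw, mul_add, map_add, h3, Pi.add_apply] at h6
  linear_combination (1 / 2 : ℂ) * h6

/-! ### Covectors and evaluation of the bracket -/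

open Classical in
/-- The coefficients of the differential of `√(y_i y_{i'})` in logarithmic coordinates. -/
def IsMoveSymmetric.meanCovector (i a : Γ.Face) : ℂ :=
  (if a = i then 1 else 0) + (if a = hΓ.mirror i then 1 else 0) +
    1 / 2 * if Γ.IsMidSquare a then (arrowCount a i : ℂ) + arrowCount i a else 0

theorem IsMoveSymmetric.sum_meanCovector (i : Γ.Face) (x : Γ.Face → ℂ) :
    ∑ a, hΓ.meanCovector i a * x a = x i + x (hΓ.mirror i) + 1 / 2 *
      ∑ a, @ite ℂ (Γ.IsMidSquare a) (Classical.propDecidable _)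
        (((arrowCount a i : ℂ) + arrowCount i a) * x a) 0 := by
  classical
  simp only [meanCovector, add_mul, Finset.sum_add_distrib, ite_mul, one_mul, zero_mul,
    Finset.sum_ite_eq', Finset.mem_univ, if_true, mul_assoc, ← Finset.mul_sum]

theorem IsMoveSymmetric.add_dsigma_eq_sum {i : Γ.Face} (hi : ¬ Γ.IsMidSquare i)
    (v : Γ.Face → ℂ) : v i + hΓ.dsigma v i = ∑ a, hΓ.meanCovector i a * v a := by
  classical
  rw [sum_meanCovector, dsigma, if_neg hi, Finset.sum_filter]
  ring

-- Only vectors with coordinate sum zero are tangent to the space of weightings; testing on `e_a -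
-- e_i` determines the logarithmic partial derivatives up to a common constant `l`.
open Classical in
theorem IsMoveSymmetric.exists_fderiv_eq {c : Γ.Face → ℝ} {i : Γ.Face}
    (hi : ¬ Γ.IsMidSquare i) {F : (Γ.Face → ℂ) → ℂ}
    (hF : hΓ.IsInvariantExtension (hΓ.geomMean c i) F) {y : Γ.Face → ℂ}
    (hy : y ∈ hΓ.msWeightings) : ∃ l : ℂ, ∀ a, y a * fderiv ℂ F y (Pi.single a 1) =
      1 / 2 * (Real.sqrt (c i) * y i) * hΓ.meanCovector i a + l := by
  have hs : ∀ a, fderiv ℂ F y (y * Pi.single a 1) = y a * fderiv ℂ F y (Pi.single a 1) := by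
    intro a
    have : y * Pi.single a 1 = y a • (Pi.single a 1 : Γ.Face → ℂ) := by
      funext b
      by_cases h : b = a
      · subst h
        simp
      · simp [h]
    rw [this, map_smul, smul_eq_mul]
  refine ⟨y i * fderiv ℂ F y (Pi.single i 1) -
    1 / 2 * (Real.sqrt (c i) * y i) * hΓ.meanCovector i i, fun a => ?_⟩
  have h := hΓ.fderiv_invariantExtension hF hy
    (v := (Pi.single a 1 : Γ.Face → ℂ) - Pi.single i 1) (by simp)
  rw [hΓ.add_dsigma_eq_sum hi, mul_sub, map_sub, hs, hs] at h
  simp only [Pi.sub_apply, mul_sub, Finset.sum_sub_distrib, Pi.single_apply, mul_ite, mul_one,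
    mul_zero, Finset.sum_ite_eq', Finset.mem_univ, if_true] at h
  linear_combination h

theorem IsMoveSymmetric.sum_q_meanCovector {i j : Γ.Face} (hi : IsUpper i) (hj : IsUpper j) :
    ∑ a, ∑ b, (Γ.q a b : ℂ) * hΓ.meanCovector i a * hΓ.meanCovector j b =
      Γ.q i j + Γ.q (hΓ.mirror i) (hΓ.mirror j) := by
  classical
  have hleft : ∀ {k}, Γ.IsMidSquare k → ∀ i, (Γ.q i k : ℂ) + Γ.q (hΓ.mirror i) k = 0 :=
    fun hk i => by exact_mod_cast q_add_q_mirror_square hΓ hk i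
  have hright : ∀ {k}, Γ.IsMidSquare k → ∀ i, (Γ.q k i : ℂ) + Γ.q k (hΓ.mirror i) = 0 := by
    intro k hk i
    have := hleft hk i
    rw [q_swap k i, q_swap k (hΓ.mirror i)]
    push_cast
    linear_combination -this
  have h0 : (Γ.q i (hΓ.mirror j) : ℂ) + Γ.q (hΓ.mirror i) j = 0 := by
    exact_mod_cast q_mirror_add hΓ hi hj
  set T : Γ.Face → ℂ := fun a => ∑ b, hΓ.meanCovector j b * (Γ.q a b : ℂ) with hT
  -- Against a square, the contributions of `j` and `j'` cancel and those of the squares are zero,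
  -- so the square terms of the other covector drop out.
  have hTk : ∀ k, Γ.IsMidSquare k → T k = 0 := by
    intro k hk
    simp only [hT]
    rw [sum_meanCovector, hright hk, zero_add, Finset.sum_eq_zero, mul_zero]
    intro l _
    split_ifs with hl
    · simp [q_eq_zero_of_squares hΓ hk hl]
    · rfl
  have h1 : ∑ a, ∑ b, (Γ.q a b : ℂ) * hΓ.meanCovector i a * hΓ.meanCovector j b =
      ∑ a, hΓ.meanCovector i a * T a := by
    refine Finset.sum_congr rfl fun a _ => ?_
    rw [hT, Finset.mul_sum]
    exact Finset.sum_congr rfl fun b _ => by ring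
  rw [h1, sum_meanCovector, Finset.sum_eq_zero, mul_zero, add_zero]
  · simp only [hT]
    rw [← Finset.sum_add_distrib]
    simp only [← mul_add]
    rw [sum_meanCovector, Finset.sum_eq_zero]
    · linear_combination h0
    · intro k _
      split_ifs with hk
      · rw [hleft hk, mul_zero]
      · rfl
  · intro k _
    split_ifs with hk
    · rw [hTk k hk, mul_zero]
    · rfl

/-- Rows and columns of `q` sum to zero, that is, the product of all weights is a Casimir function;
this removes the undetermined constants of `exists_fderiv_eq`. -/
theorem sum_q_add_const (f g : Γ.Face → ℂ) (k l : ℂ) :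
    ∑ a, ∑ b, (Γ.q a b : ℂ) * (f a + k) * (g b + l) =
      ∑ a, ∑ b, (Γ.q a b : ℂ) * f a * g b := by
  have hr : ∀ a, ∑ b, (Γ.q a b : ℂ) = 0 := fun a => by exact_mod_cast sum_q_eq_zero a
  have hc : ∀ b, ∑ a, (Γ.q a b : ℂ) = 0 := fun b => by
    have := hr b
    rw [← neg_eq_zero, ← Finset.sum_neg_distrib]
    rw [← this]
    refine Finset.sum_congr rfl fun a _ => ?_
    rw [q_swap b a]
    push_cast
    ring
  have h1 : ∀ a b, (Γ.q a b : ℂ) * (f a + k) * (g b + l) = (Γ.q a b : ℂ) * f a * g b +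
      k * g b * Γ.q a b + l * (f a + k) * Γ.q a b := fun a b => by ring
  simp only [h1, Finset.sum_add_distrib]
  have h2 : ∑ a, ∑ b, k * g b * (Γ.q a b : ℂ) = 0 := by
    rw [Finset.sum_comm]
    exact Finset.sum_eq_zero fun b _ => by rw [← Finset.mul_sum, hc, mul_zero]
  have h3 : ∑ a, ∑ b, l * (f a + k) * (Γ.q a b : ℂ) = 0 :=
    Finset.sum_eq_zero fun a _ => by rw [← Finset.mul_sum, hr, mul_zero]
  rw [h2, h3, add_zero, add_zero]

theorem IsMoveSymmetric.isInducedBracket_geomMean (c : Γ.Face → ℝ) {i j : Γ.Face}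
    (hi : IsUpper i) (hj : IsUpper j) :
    hΓ.IsInducedBracket (hΓ.geomMean c i) (hΓ.geomMean c j)
      (fun y => 1 / 4 * ((Γ.q i j : ℂ) + (Γ.q (hΓ.mirror i) (hΓ.mirror j) : ℂ)) *
        hΓ.geomMean c i y * hΓ.geomMean c j y) := by
  classical
  have hi' := not_isMidSquare_of_isUpper hi
  have hj' := not_isMidSquare_of_isUpper hj
  refine ⟨hΓ.exists_isInvariantExtension c hi', hΓ.exists_isInvariantExtension c hj',
    fun F G hF hG y => ?_⟩
  obtain ⟨k, hk⟩ := hΓ.exists_fderiv_eq hi' hF y.2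
  obtain ⟨l, hl⟩ := hΓ.exists_fderiv_eq hj' hG y.2
  have h1 : Γ.bracket F G y = ∑ a, ∑ b, (Γ.q a b : ℂ) *
      (y.1 a * fderiv ℂ F y (Pi.single a 1)) * (y.1 b * fderiv ℂ G y (Pi.single b 1)) := by
    unfold bracket
    refine Finset.sum_congr rfl fun a _ => Finset.sum_congr rfl fun b _ => ?_
    ring
  simp only [h1, hk, hl]
  rw [sum_q_add_const]
  have h2 : ∀ a b, (Γ.q a b : ℂ) * (1 / 2 * (Real.sqrt (c i) * y.1 i) * hΓ.meanCovector i a) *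
      (1 / 2 * (Real.sqrt (c j) * y.1 j) * hΓ.meanCovector j b) =
      1 / 4 * (Real.sqrt (c i) * y.1 i) * (Real.sqrt (c j) * y.1 j) *
        ((Γ.q a b : ℂ) * hΓ.meanCovector i a * hΓ.meanCovector j b) := fun a b => by ring
  simp only [h2, ← Finset.mul_sum]
  rw [hΓ.sum_q_meanCovector hi hj]
  simp only [geomMean]
  ring

end

end PlabicGraph

end

theorem mainTheorem9 {n : ℕ} (hn : Odd n) (Γ : PlabicGraph n) (hΓ : Γ.IsMoveSymmetric) :
    (∃ c : Γ.Face → ℝ, hΓ.IsMirrorRatio c) ∧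
    ∀ c : Γ.Face → ℝ, hΓ.IsMirrorRatio c →
      ∀ i j : Γ.Face, PlabicGraph.IsUpper i → PlabicGraph.IsUpper j →
        hΓ.IsInducedBracket (hΓ.geomMean c i) (hΓ.geomMean c j)
          (fun y => 1 / 4 * ((Γ.q i j : ℂ) + (Γ.q (hΓ.mirror i) (hΓ.mirror j) : ℂ)) *
            hΓ.geomMean c i y * hΓ.geomMean c j y) :=
  ⟨⟨_, hΓ.isMirrorRatio_ratio⟩, fun c _ _ _ hi hj => hΓ.isInducedBracket_geomMean c hi hj⟩
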